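/- Let $p,d\ge 0$ be integers and let $\mathrm{St}(p,d)=\{V\in\mathbb R^{p\times d}: V^\top V=I_d\}$ be the Stiefel manifold with the Riemannian metric induced by the Frobenius inner product. Let $f:\mathrm{St}(p,d)\to\mathbb R$ be the contrastive inverse regression (CIR) loss with weight $\alpha\ge 0$, i.e. one of the following two functions. (a) Population loss. $(x,y)$ and $(\tilde x,\tilde y)$ are random elements of $\mathbb R^p\times\mathbb R$, $x,\tilde x$ are square integrable with mean $0$ and nonsingular covariance matrices $\Sigma_{xx},\Sigma_{\tilde x\tilde x}$, and $$f(V)=\mathbb E\big[\operatorname{dist}^2\big(\mathbb E[x\mid y],\mathcal C(\Sigma_{xx}V)\big)\big]-\alpha\,\mathbb E\big[\operatorname{dist}^2\big(\mathbb E[\tilde x\mid\tilde y],\mathcal C(\Sigma_{\tilde x\tilde x}V)\big)\big],$$ where $\mathcal C$ denotes the column space and $\operatorname{dist}$ the Euclidean distance. (b) Sample loss. Given samples $(x_i,y_i)_{i\le n}$ and $(\tilde x_j,\tilde y_j)_{j\le m}$ in $\mathbb R^p\times\mathbb R$, where the $x_i$ and the $\tilde x_j$ have been centered by subtracting their sample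 means, and given sets (slices) $I_1,\dots,I_H$ and $\tilde I_1,\dots,\tilde I_{\tilde H}$ of reals, each containing at least one of the respective responses, put $\Sigma_{xx}=\frac1n\sum_i x_ix_i^\top$ and $\Sigma_x=\sum_h m_hm_h^\top$, with $m_h$ the mean of the $x_i$ with $y_i\in I_h$, and define $\Sigma_{\tilde x\tilde x},\Sigma_{\tilde x}$ likewise; $\Sigma_{xx},\Sigma_{\tilde x\tilde x}$ are assumed nonsingular. With $A=\Sigma_{xx}\Sigma_x\Sigma_{xx}$, $B=\Sigma_{xx}^2$, $\tilde A=\Sigma_{\tilde x\tilde x}\Sigma_{\tilde x}\Sigma_{\tilde x\tilde x}$, $\tilde B=\Sigma_{\tilde x\tilde x}^2$, $$f(V)=-\operatorname{tr}\big(V^\top AV(V^\top BV)^{-1}\big)+\alpha\operatorname{tr}\big(V^\top\tilde AV(V^\top\tilde BV)^{-1}\big).$$ Let $R:T\,\mathrm{St}(p,d)\to\mathrm{St}(p,d)$ be a retraction (a smooth map with $R_V(0)=V$ and $DR_V(0)=\mathrm{id}$ for every $V$), let $\bar\alpha>0$ and $c,\beta,\sigma\in(0,1)$, and let $(V_k)_{k\ge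 0}$ in $\mathrm{St}(p,d)$ be an infinite sequence generated by the accelerated line search with $\eta_k=-\operatorname{grad} f(V_k)$, i.e. $$f(V_k)-f(V_{k+1})\ \ge\ c\,\big(f(V_k)-f(R_{V_k}(t_k^A\eta_k))\big)\qquad(k\ge0),$$ where $t_k^A=\beta^{m}\bar\alpha$ is the Armijo step size, $m$ being the least nonnegative integer such that $f(V_k)-f(R_{V_k}(\beta^{m}\bar\alpha\eta_k))\ge-\sigma\langle\operatorname{grad} f(V_k),\beta^{m}\bar\alpha\eta_k\rangle$. Then every accumulation point of $(V_k)$ is a critical point of $f$, and $\lim_{k\to\infty}\|\operatorname{grad} f(V_k)\|=0$. Suppose furthermore that $(V_k)$ converges to a point $V_*$ which is a local minimizer of $f$ on $\mathrm{St}(p,d)$, and that the smallest eigenvalue $\lambda_l$ and the largest eigenvalue $\lambda_u$ of the Riemannian Hessian $\operatorname{Hess} f(V_*)$ on $T_{V_*}\mathrm{St}(p,d)$ satisfy $0<\lambda_l\le\lambda_u$. Put $$r_*=1-\min\Big(2\sigma\bar\alpha\lambda_l,\ 4\sigma(1-\sigma)\beta\frac{\lambda_l}{\lambda_u}\Big).$$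 Then $r_*<1$, and for every $r\in(r_*,1)$ one has $r+(1-r)(1-c)\in(0,1)$ and there is an integer $K\ge 1$ such that $$f(V_{k+1})-f(V_*)\ \le\ \big(r+(1-r)(1-c)\big)\,\big(f(V_k)-f(V_*)\big)\qquad\text{for all }k\ge K,$$ so that $f(V_k)\to f(V_*)$ linearly. -/

import Mathlib

open Filter Topology MeasureTheory ProbabilityTheory
open scoped Matrix

universe u v

noncomputable section

namespace CIR

/-! ### The space of `p × d` matrices with the Frobenius inner product -/

/-- The space `ℝ^{p×d}` with the Frobenius inner product `⟨A, B⟩ = tr(Aᵀ B)`. -/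
abbrev Mat (p d : ℕ) : Type := EuclideanSpace ℝ (Fin p × Fin d)

/-- An element of `Mat p d` as a matrix. -/
def mat {p d : ℕ} (V : Mat p d) : Matrix (Fin p) (Fin d) ℝ :=
  Matrix.of fun i j => V (i, j)

/-- A matrix as an element of `Mat p d`. -/
def unmat {p d : ℕ} (M : Matrix (Fin p) (Fin d) ℝ) : Mat p d :=
  WithLp.toLp 2 fun ij => M ij.1 ij.2

/-! ### The Stiefel manifold as a Riemannian submanifold of `ℝ^{p×d}` -/

/-- The Stiefel manifold `St(p,d) = {V : Vᵀ V = I_d}`. -/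
def stiefel (p d : ℕ) : Set (Mat p d) :=
  {V | (mat V)ᵀ * mat V = 1}

/-- The tangent space `T_V St(p,d) = {ξ : Vᵀ ξ + ξᵀ V = 0}`, as a set of ambient vectors. -/
def tangentSpace {p d : ℕ} (V : Mat p d) : Set (Mat p d) :=
  {ξ | (mat V)ᵀ * mat ξ + (mat ξ)ᵀ * mat V = 0}

/-- The tangent bundle of `St(p,d)`, embedded in `ℝ^{p×d} × ℝ^{p×d}`. -/
def tangentBundle (p d : ℕ) : Set (Mat p d × Mat p d) :=
  {q | q.1 ∈ stiefel p d ∧ q.2 ∈ tangentSpace q.1}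

/-- `proj_V(Z) = Z - V sym(Vᵀ Z)`; for `V ∈ St(p,d)` this is the orthogonal projection onto
`T_V St(p,d)`. -/
def proj {p d : ℕ} (V Z : Mat p d) : Mat p d :=
  Z - unmat (mat V * ((1 / 2 : ℝ) • ((mat V)ᵀ * mat Z + ((mat V)ᵀ * mat Z)ᵀ)))

/-- The Riemannian gradient on `St(p,d)` of a function `f` given on the ambient space (and
differentiable near `St(p,d)`): the projection of the Euclidean gradient. -/
def rgrad {p d : ℕ} (f : Mat p d → ℝ) (V : Mat p d) : Mat p d :=
  proj V (gradient f V)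

/-- The Riemannian Hessian `Hess f(V)[ξ] = ∇_ξ grad f` at `V ∈ St(p,d)`, where `∇` is the
Levi-Civita connection of the submanifold: the projection of the ambient derivative of the
gradient field. -/
def rhess {p d : ℕ} (f : Mat p d → ℝ) (V ξ : Mat p d) : Mat p d :=
  proj V (fderiv ℝ (rgrad f) V ξ)

/-- The eigenvalues of `Hess f(V) : T_V St(p,d) → T_V St(p,d)`. -/
def hessEigenvalues {p d : ℕ} (f : Mat p d → ℝ) (V : Mat p d) : Set ℝ :=
  {lam | ∃ ξ ∈ tangentSpace V, ξ ≠ 0 ∧ rhess f V ξ = lam • ξ}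

/-- Critical points of `f` on `St(p,d)`. -/
def IsCriticalPoint {p d : ℕ} (f : Mat p d → ℝ) (V : Mat p d) : Prop :=
  V ∈ stiefel p d ∧ rgrad f V = 0

/-- A retraction on `St(p,d)`: a smooth map `R` from the tangent bundle to `St(p,d)` with
`R_V(0) = V` and `D R_V(0) = id` on `T_V St(p,d)`. Values off the tangent bundle are
irrelevant. -/
structure IsRetraction {p d : ℕ} (R : Mat p d → Mat p d → Mat p d) : Prop where
  mapsTo : ∀ V ∈ stiefel p d, ∀ ξ ∈ tangentSpace V, R V ξ ∈ stiefel p d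
  smooth : ContDiffOn ℝ (⊤ : ℕ∞) (fun q : Mat p d × Mat p d => R q.1 q.2) (tangentBundle p d)
  map_zero : ∀ V ∈ stiefel p d, R V 0 = V
  deriv_zero : ∀ V ∈ stiefel p d, ∀ ξ ∈ tangentSpace V,
    HasDerivAt (fun t : ℝ => R V (t • ξ)) ξ 0

/-! ### The accelerated line search -/

/-- `t = β^m * abar` is the Armijo step size for `f` at `V` in the direction `η`: `m` is the least
nonnegative integer with
`f(V) - f(R_V(β^m abar η)) ≥ -σ ⟨grad f(V), β^m abar η⟩`. -/
def IsArmijoStep {p d : ℕ} (f : Mat p d → ℝ) (R : Mat p d → Mat p d → Mat p d)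
    (abar β σ : ℝ) (V η : Mat p d) (t : ℝ) : Prop :=
  ∃ m : ℕ,
    IsLeast {m : ℕ | f V - f (R V ((β ^ m * abar) • η)) ≥
      -σ * inner ℝ (rgrad f V) ((β ^ m * abar) • η)} m ∧
    t = β ^ m * abar

/-- `V 0, V 1, …` is generated by the accelerated line search with search directions
`η_k = -grad f(V_k)`: `V_{k+1}` is any point of `St(p,d)` with
`f(V_k) - f(V_{k+1}) ≥ c (f(V_k) - f(R_{V_k}(t_k η_k)))`, `t_k` the Armijo step size. -/
structure IsALSSequence {p d : ℕ} (f : Mat p d → ℝ) (R : Mat p d → Mat p d → Mat p d)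
    (abar β σ c : ℝ) (V : ℕ → Mat p d) : Prop where
  mem : ∀ k, V k ∈ stiefel p d
  step : ∀ k, ∃ t : ℝ, IsArmijoStep f R abar β σ (V k) (-rgrad f (V k)) t ∧
    f (V k) - f (V (k + 1)) ≥ c * (f (V k) - f (R (V k) (t • -rgrad f (V k))))

/-- `r_* = 1 - min(2 σ abar λ_l, 4 σ (1-σ) β λ_l / λ_u)`. -/
def rStar (abar β σ lamL lamU : ℝ) : ℝ :=
  1 - min (2 * σ * abar * lamL) (4 * σ * (1 - σ) * β * (lamL / lamU))

/-! ### The CIR loss -/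

/-- The column space of a matrix with `p` rows, as a subspace of Euclidean `ℝ^p`. -/
def colSpace {p d : ℕ} (M : Matrix (Fin p) (Fin d) ℝ) : Submodule ℝ (EuclideanSpace ℝ (Fin p)) :=
  Submodule.span ℝ (Set.range fun j : Fin d => WithLp.toLp 2 fun i => M i j)

/-- The covariance matrix of a random vector. -/
def covMatrix {Ω : Type u} [MeasurableSpace Ω] {p : ℕ} (μ : Measure Ω)
    (x : Ω → EuclideanSpace ℝ (Fin p)) : Matrix (Fin p) (Fin p) ℝ :=
  Matrix.of fun i j => cov[fun ω => x ω i, fun ω => x ω j; μ]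

/-- `E_y[ dist(E[x | y], C(Σ_xx V))² ]`, with `Σ_xx = Cov(x)`. -/
def invRegLoss {Ω : Type u} [MeasurableSpace Ω] {p d : ℕ} (μ : Measure Ω)
    (x : Ω → EuclideanSpace ℝ (Fin p)) (y : Ω → ℝ) (V : Mat p d) : ℝ :=
  ∫ ω, (Metric.infDist ((μ[x | MeasurableSpace.comap y inferInstance]) ω)
    (colSpace (covMatrix μ x * mat V) : Set (EuclideanSpace ℝ (Fin p)))) ^ 2 ∂μ

/-- `tr(Vᵀ A V (Vᵀ B V)⁻¹)` with `A = Sxx Sx Sxx` and `B = Sxx²`. -/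
def traceTerm {p d : ℕ} (Sxx Sx : Matrix (Fin p) (Fin p) ℝ) (V : Mat p d) : ℝ :=
  Matrix.trace ((mat V)ᵀ * (Sxx * Sx * Sxx) * mat V * ((mat V)ᵀ * (Sxx ^ 2) * mat V)⁻¹)

/-- The `i`-th centered sample `x_i - (1/n) ∑ x_l`; the rows of `X` are the samples. -/
def centered {n p : ℕ} (X : Matrix (Fin n) (Fin p) ℝ) (i : Fin n) : Fin p → ℝ :=
  X i - (1 / (n : ℝ)) • ∑ l, X l

/-- The sample covariance matrix `(1/n) ∑ x_i x_iᵀ` of the centered samples. -/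
def sampleCov {n p : ℕ} (X : Matrix (Fin n) (Fin p) ℝ) : Matrix (Fin p) (Fin p) ℝ :=
  (1 / (n : ℝ)) • ∑ i, Matrix.vecMulVec (centered X i) (centered X i)

/-- The proportion `p_h` of the responses that lie in the slice `I`. -/
def sliceProp {n : ℕ} (Y : Fin n → ℝ) (I : Set ℝ) : ℝ :=
  (1 / (n : ℝ)) * ∑ i, I.indicator (fun _ => (1 : ℝ)) (Y i)

/-- The slice mean `m_h = (1/(n p_h)) ∑_{y_i ∈ I_h} x_i` of the centered samples. -/
def sliceMean {n p : ℕ} (X : Matrix (Fin n) (Fin p) ℝ) (Y : Fin n → ℝ) (I : Set ℝ) :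
    Fin p → ℝ :=
  (1 / ((n : ℝ) * sliceProp Y I)) •
    ∑ i, I.indicator (fun _ => (1 : ℝ)) (Y i) • centered X i

/-- The sliced estimate `∑_h m_h m_hᵀ` of the covariance of the inverse regression curve. -/
def sliceCov {n p H : ℕ} (X : Matrix (Fin n) (Fin p) ℝ) (Y : Fin n → ℝ) (I : Fin H → Set ℝ) :
    Matrix (Fin p) (Fin p) ℝ :=
  ∑ h, Matrix.vecMulVec (sliceMean X Y (I h)) (sliceMean X Y (I h))

/-- The loss functions minimized by contrastive inverse regression: the population loss, for
centered square-integrable covariates, and its plug-in version for finite samples and nonempty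
response slices. The (sample) covariance matrices are nonsingular, so that the matrices inverted
in the loss are invertible on the whole Stiefel manifold. -/
inductive IsCIRLoss (p d : ℕ) : (Mat p d → ℝ) → Prop
  | population {Ω : Type u} {Ω' : Type v} [MeasurableSpace Ω] [MeasurableSpace Ω']
      (μ : Measure Ω) (μ' : Measure Ω') [IsProbabilityMeasure μ] [IsProbabilityMeasure μ']
      (x : Ω → EuclideanSpace ℝ (Fin p)) (y : Ω → ℝ)
      (x' : Ω' → EuclideanSpace ℝ (Fin p)) (y' : Ω' → ℝ) (α : ℝ)
      (hx : MemLp x 2 μ) (hx' : MemLp x' 2 μ') (hy : Measurable y) (hy' : Measurable y')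
      (hx0 : ∫ ω, x ω ∂μ = 0) (hx0' : ∫ ω, x' ω ∂μ' = 0)
      (hcov : (covMatrix μ x).PosDef) (hcov' : (covMatrix μ' x').PosDef) (hα : 0 ≤ α) :
      IsCIRLoss p d fun V => invRegLoss μ x y V - α * invRegLoss μ' x' y' V
  | sample {n n' H H' : ℕ}
      (X : Matrix (Fin n) (Fin p) ℝ) (Y : Fin n → ℝ) (I : Fin H → Set ℝ)
      (X' : Matrix (Fin n') (Fin p) ℝ) (Y' : Fin n' → ℝ) (I' : Fin H' → Set ℝ) (α : ℝ)
      (hI : ∀ h, ∃ i, Y i ∈ I h) (hI' : ∀ h, ∃ i, Y' i ∈ I' h)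
      (hcov : (sampleCov X).PosDef) (hcov' : (sampleCov X').PosDef) (hα : 0 ≤ α) :
      IsCIRLoss p d fun V =>
        -traceTerm (sampleCov X) (sliceCov X Y I) V +
          α * traceTerm (sampleCov X') (sliceCov X' Y' I') V

end CIR

end

noncomputable section

namespace CIR

/-! ### Matrix algebra in `Mat p d` -/

section Algebra

variable {p d q : ℕ}

/-! Only two facts about the loss matter: it is `C²` on an ambient neighbourhood of each point of
the compact Stiefel manifold (`IsCIRLoss.contDiffAt`), and its values along the sequence decrease by
at least `c` times the Armijo decrease.

Global part. The values decrease and are bounded below, so consecutive differences tend to 0. Near a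
noncritical point a rejected trial step cannot be short, so Armijo decreases stay above a positive
constant there (`exists_armijo_decrease_lower_bound`); hence accumulation points are critical, and
compactness upgrades this to gradients tending to 0.

Local part. At the limit `a`, `f` is replaced by the Lagrangian `L` with the multiplier of `a`. It
agrees with `f` on the manifold, its full ambient derivative vanishes at `a`, and its ambient
Hessian restricted to the tangent space is the Riemannian Hessian. The estimates thus become Taylor
expansions in flat space (`IsLocalModel`). They give `2(l-ε)(f x - f a) ≤ ‖grad f x‖²` and an upper
quadratic bound along the retraction with constant `u+ε`. The latter forces a rejected trial step
`s` to satisfy `s ≥ 2(1-σ-ε)/(u+ε)` when the gradient is nonzero. So the Armijo step is `abar` or at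
least `2β(1-σ-ε)/(u+ε)`, which produces the two terms of the minimum in `rStar`. -/

@[simp] lemma mat_apply (V : Mat p d) (i : Fin p) (j : Fin d) : mat V i j = V (i, j) := rfl

@[simp] lemma unmat_apply (M : Matrix (Fin p) (Fin d) ℝ) (ij : Fin p × Fin d) :
    unmat M ij = M ij.1 ij.2 := rfl

@[simp] lemma mat_unmat (M : Matrix (Fin p) (Fin d) ℝ) : mat (unmat M) = M := rfl

@[simp] lemma unmat_mat (V : Mat p d) : unmat (mat V) = V := rfl

@[simp] lemma mat_add (V W : Mat p d) : mat (V + W) = mat V + mat W := rfl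

@[simp] lemma mat_sub (V W : Mat p d) : mat (V - W) = mat V - mat W := rfl

@[simp] lemma mat_smul (a : ℝ) (V : Mat p d) : mat (a • V) = a • mat V := rfl

lemma unmat_add (M N : Matrix (Fin p) (Fin d) ℝ) : unmat (M + N) = unmat M + unmat N := rfl

lemma unmat_sub (M N : Matrix (Fin p) (Fin d) ℝ) : unmat (M - N) = unmat M - unmat N := rfl

lemma unmat_smul (a : ℝ) (M : Matrix (Fin p) (Fin d) ℝ) : unmat (a • M) = a • unmat M := rfl

@[simp] lemma unmat_zero : unmat (0 : Matrix (Fin p) (Fin d) ℝ) = 0 := rfl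

lemma inner_eq_trace (V W : Mat p d) : inner ℝ V W = Matrix.trace ((mat V)ᵀ * mat W) := by
  rw [PiLp.inner_apply, Fintype.sum_prod_type, Finset.sum_comm]
  simp [Matrix.trace, Matrix.mul_apply, mul_comm]

lemma norm_sq_unmat (M : Matrix (Fin p) (Fin d) ℝ) : ‖unmat M‖ ^ 2 = ∑ i, ∑ j, M i j ^ 2 := by
  rw [EuclideanSpace.real_norm_sq_eq, Fintype.sum_prod_type]
  rfl

lemma norm_unmat_transpose (M : Matrix (Fin p) (Fin d) ℝ) : ‖unmat Mᵀ‖ = ‖unmat M‖ := by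
  rw [← sq_eq_sq₀ (norm_nonneg _) (norm_nonneg _), norm_sq_unmat, norm_sq_unmat, Finset.sum_comm]
  rfl

lemma norm_unmat_mul_le (M : Matrix (Fin p) (Fin q) ℝ) (N : Matrix (Fin q) (Fin d) ℝ) :
    ‖unmat (M * N)‖ ≤ ‖unmat M‖ * ‖unmat N‖ := by
  refine le_of_sq_le_sq ?_ (by positivity)
  rw [mul_pow, norm_sq_unmat, norm_sq_unmat, norm_sq_unmat, Finset.sum_mul]
  refine Finset.sum_le_sum fun i _ => ?_
  rw [Finset.sum_comm (s := Finset.univ) (t := Finset.univ), Finset.mul_sum]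
  refine Finset.sum_le_sum fun j _ => ?_
  rw [Matrix.mul_apply]
  exact Finset.sum_mul_sq_le_sq_mul_sq _ _ _

/-- The symmetric part of `Vᵀ Z`. -/
def symPart (V Z : Mat p d) : Matrix (Fin d) (Fin d) ℝ :=
  (1 / 2 : ℝ) • ((mat V)ᵀ * mat Z + ((mat V)ᵀ * mat Z)ᵀ)

lemma proj_eq (V Z : Mat p d) : proj V Z = Z - unmat (mat V * symPart V Z) := rfl

lemma symPart_transpose (V Z : Mat p d) : (symPart V Z)ᵀ = symPart V Z := by
  simp [symPart, add_comm]

lemma symPart_add (V Z W : Mat p d) : symPart V (Z + W) = symPart V Z + symPart V W := by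
  simp only [symPart, mat_add, Matrix.mul_add, Matrix.transpose_add, ← smul_add]
  abel_nf

lemma symPart_smul (a : ℝ) (V Z : Mat p d) : symPart V (a • Z) = a • symPart V Z := by
  simp only [symPart, mat_smul, Matrix.mul_smul, Matrix.transpose_smul, ← smul_add]
  rw [smul_comm]

lemma symPart_sub_left (V W Z : Mat p d) : symPart (V - W) Z = symPart V Z - symPart W Z := by
  simp only [symPart, mat_sub, Matrix.sub_mul, Matrix.transpose_sub, ← smul_sub]
  congr 1
  abel

lemma symPart_sub_right (V Z W : Mat p d) : symPart V (Z - W) = symPart V Z - symPart V W := by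
  simp only [symPart, mat_sub, Matrix.mul_sub, Matrix.transpose_sub, ← smul_sub]
  congr 1
  abel

lemma symPart_comm (V Z : Mat p d) : symPart V Z = symPart Z V := by
  simp [symPart, add_comm]

lemma norm_symPart_le (V Z : Mat p d) : ‖unmat (symPart V Z)‖ ≤ ‖V‖ * ‖Z‖ := by
  have h : ‖unmat ((mat V)ᵀ * mat Z)‖ ≤ ‖V‖ * ‖Z‖ := by
    simpa [norm_unmat_transpose] using norm_unmat_mul_le (mat V)ᵀ (mat Z)
  rw [symPart, unmat_smul, unmat_add, norm_smul]
  have h2 := norm_add_le (unmat ((mat V)ᵀ * mat Z)) (unmat ((mat V)ᵀ * mat Z)ᵀ)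
  rw [norm_unmat_transpose] at h2
  rw [Real.norm_of_nonneg (by norm_num)]
  linarith

lemma mem_tangentSpace_iff {V ξ : Mat p d} : ξ ∈ tangentSpace V ↔ symPart V ξ = 0 := by
  rw [symPart, smul_eq_zero_iff_right (by norm_num : (1 / 2 : ℝ) ≠ 0), Matrix.transpose_mul,
    Matrix.transpose_transpose]
  rfl

lemma symPart_self {V : Mat p d} (hV : V ∈ stiefel p d) : symPart V V = 1 := by
  have h : (mat V)ᵀ * mat V = 1 := hV
  rw [symPart, h, Matrix.transpose_one, ← two_smul ℝ, smul_smul]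
  norm_num

lemma symPart_mul {V : Mat p d} (hV : V ∈ stiefel p d) {S : Matrix (Fin d) (Fin d) ℝ}
    (hS : Sᵀ = S) : symPart V (unmat (mat V * S)) = S := by
  have h : (mat V)ᵀ * mat V = 1 := hV
  rw [symPart, mat_unmat, ← Matrix.mul_assoc, h, Matrix.one_mul, hS, ← two_smul ℝ, smul_smul]
  norm_num

/-- A symmetric `S` pairs to zero with the antisymmetric part of `Vᵀ ξ`. In particular the matrices
`V S` are normal to the tangent space. -/
lemma inner_mul_eq_trace {S : Matrix (Fin d) (Fin d) ℝ} (hS : Sᵀ = S) (V ξ : Mat p d) :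
    inner ℝ (unmat (mat V * S)) ξ = Matrix.trace (S * symPart V ξ) := by
  have h : Matrix.trace (S * ((mat V)ᵀ * mat ξ)ᵀ) = Matrix.trace (S * ((mat V)ᵀ * mat ξ)) := by
    rw [← Matrix.trace_transpose, Matrix.transpose_mul, Matrix.transpose_transpose, hS,
      Matrix.trace_mul_comm]
  rw [inner_eq_trace, mat_unmat, Matrix.transpose_mul, hS, symPart, Matrix.mul_smul,
    Matrix.trace_smul, Matrix.mul_add, Matrix.trace_add, h, Matrix.mul_assoc, smul_eq_mul]
  ring

lemma inner_mul_eq_zero {S : Matrix (Fin d) (Fin d) ℝ} (hS : Sᵀ = S) {V ξ : Mat p d}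
    (hξ : ξ ∈ tangentSpace V) : inner ℝ (unmat (mat V * S)) ξ = 0 := by
  rw [inner_mul_eq_trace hS, mem_tangentSpace_iff.1 hξ, Matrix.mul_zero, Matrix.trace_zero]

lemma inner_proj_left {V ξ : Mat p d} (hξ : ξ ∈ tangentSpace V) (Z : Mat p d) :
    inner ℝ (proj V Z) ξ = inner ℝ Z ξ := by
  rw [proj_eq, inner_sub_left, inner_mul_eq_zero (symPart_transpose _ _) hξ, sub_zero]

lemma inner_proj_right {V ξ : Mat p d} (hξ : ξ ∈ tangentSpace V) (Z : Mat p d) :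
    inner ℝ ξ (proj V Z) = inner ℝ ξ Z := by
  rw [real_inner_comm, inner_proj_left hξ, real_inner_comm]

lemma proj_mem {V : Mat p d} (hV : V ∈ stiefel p d) (Z : Mat p d) :
    proj V Z ∈ tangentSpace V := by
  rw [mem_tangentSpace_iff, proj_eq, symPart_sub_right, symPart_mul hV (symPart_transpose _ _),
    sub_self]

lemma proj_of_mem {V ξ : Mat p d} (hξ : ξ ∈ tangentSpace V) : proj V ξ = ξ := by
  rw [proj_eq, mem_tangentSpace_iff.1 hξ, Matrix.mul_zero, unmat_zero, sub_zero]

lemma proj_add (V Z W : Mat p d) : proj V (Z + W) = proj V Z + proj V W := by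
  simp only [proj_eq, symPart_add, Matrix.mul_add, unmat_add]
  abel

lemma proj_smul (a : ℝ) (V Z : Mat p d) : proj V (a • Z) = a • proj V Z := by
  simp only [proj_eq, symPart_smul, Matrix.mul_smul, unmat_smul, smul_sub]

/-- The tangent space as a linear subspace. -/
def tangentSubmodule (V : Mat p d) : Submodule ℝ (Mat p d) where
  carrier := tangentSpace V
  add_mem' {a b} ha hb := by
    rw [mem_tangentSpace_iff] at *
    rw [symPart_add, ha, hb, add_zero]
  zero_mem' := by
    rw [mem_tangentSpace_iff, ← zero_smul ℝ (0 : Mat p d), symPart_smul, zero_smul]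
  smul_mem' c x hx := by
    rw [mem_tangentSpace_iff] at *
    rw [symPart_smul, hx, smul_zero]

/-- The base point occurs twice, bilinearly, in the normal part `V sym(Vᵀ Z)`; the difference
telescopes. -/
lemma norm_proj_sub_proj_le (V W Z : Mat p d) :
    ‖proj V Z - proj W Z‖ ≤ (‖V‖ + ‖W‖) * ‖V - W‖ * ‖Z‖ := by
  have h : proj V Z - proj W Z =
      -(unmat (mat (V - W) * symPart V Z) + unmat (mat W * symPart (V - W) Z)) := by
    rw [proj_eq, proj_eq, symPart_sub_left, mat_sub, ← unmat_add, Matrix.sub_mul, Matrix.mul_sub]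
    simp only [unmat_add, unmat_sub]
    abel
  rw [h, norm_neg]
  refine (norm_add_le _ _).trans ?_
  have h1 := (norm_unmat_mul_le (mat (V - W)) (symPart V Z)).trans
    (mul_le_mul_of_nonneg_left (norm_symPart_le V Z) (norm_nonneg _))
  have h2 := (norm_unmat_mul_le (mat W) (symPart (V - W) Z)).trans
    (mul_le_mul_of_nonneg_left (norm_symPart_le (V - W) Z) (norm_nonneg _))
  rw [unmat_mat] at h1 h2
  linarith

/-- Chords are tangent to second order: `VᵀV = WᵀW = I` gives `sym(Vᵀ(V-W)) = ½ (V-W)ᵀ(V-W)`. -/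
lemma norm_sub_proj_le {V W : Mat p d} (hV : V ∈ stiefel p d) (hW : W ∈ stiefel p d) :
    ‖(V - W) - proj V (V - W)‖ ≤ ‖V‖ * ‖V - W‖ ^ 2 := by
  have h : symPart V (V - W) = (1 / 2 : ℝ) • symPart (V - W) (V - W) := by
    rw [symPart_sub_left, symPart_sub_right, symPart_sub_right, symPart_self hV, symPart_self hW,
      symPart_comm W V]
    module
  rw [proj_eq, sub_sub_cancel]
  refine (norm_unmat_mul_le _ _).trans ?_
  rw [unmat_mat]
  refine mul_le_mul_of_nonneg_left ?_ (norm_nonneg _)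
  rw [h, unmat_smul, norm_smul, Real.norm_of_nonneg (by norm_num)]
  nlinarith [norm_symPart_le (V - W) (V - W), sq_nonneg ‖V - W‖]

lemma norm_sq_of_mem_stiefel {V : Mat p d} (hV : V ∈ stiefel p d) : ‖V‖ ^ 2 = d := by
  have h : (mat V)ᵀ * mat V = 1 := hV
  rw [← real_inner_self_eq_norm_sq, inner_eq_trace, h]
  simp

end Algebra

/-! ### Smoothness of matrix operations and compactness of the Stiefel manifold -/

section Smooth

variable {p d : ℕ}

lemma contDiffAt_symPart_apply {F : Type*} [NormedAddCommGroup F] [NormedSpace ℝ F]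
    {n : WithTop ℕ∞} {g h : F → Mat p d} {x : F} (hg : ContDiffAt ℝ n g x)
    (hh : ContDiffAt ℝ n h x) (i j : Fin d) :
    ContDiffAt ℝ n (fun y => symPart (g y) (h y) i j) x := by
  have h1 : ∀ ij : Fin p × Fin d, ContDiffAt ℝ n (fun y => g y ij) x :=
    contDiffAt_euclidean.1 hg
  have h2 : ∀ ij : Fin p × Fin d, ContDiffAt ℝ n (fun y => h y ij) x :=
    contDiffAt_euclidean.1 hh
  simp only [symPart, Matrix.smul_apply, Matrix.add_apply, Matrix.transpose_apply,
    Matrix.mul_apply, mat_apply, smul_eq_mul]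
  exact contDiffAt_const.mul ((ContDiffAt.sum fun k _ => (h1 (k, i)).mul (h2 (k, j))).add
    (ContDiffAt.sum fun k _ => (h1 (k, j)).mul (h2 (k, i))))

lemma contDiffAt_proj {F : Type*} [NormedAddCommGroup F] [NormedSpace ℝ F]
    {n : WithTop ℕ∞} {g h : F → Mat p d} {x : F} (hg : ContDiffAt ℝ n g x)
    (hh : ContDiffAt ℝ n h x) : ContDiffAt ℝ n (fun y => proj (g y) (h y)) x := by
  rw [contDiffAt_euclidean]
  intro ij
  simp only [proj_eq, PiLp.sub_apply, unmat_apply, Matrix.mul_apply, mat_apply]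
  exact (contDiffAt_euclidean.1 hh ij).sub (ContDiffAt.sum fun k _ =>
    (contDiffAt_euclidean.1 hg (ij.1, k)).mul (contDiffAt_symPart_apply hg hh k ij.2))

lemma isClosed_stiefel : IsClosed (stiefel p d) := by
  have h : stiefel p d = ⋂ i : Fin d, ⋂ j : Fin d,
      {V : Mat p d | symPart V V i j = (1 : Matrix (Fin d) (Fin d) ℝ) i j} := by
    ext V
    simp only [Set.mem_iInter, Set.mem_ofPred_eq]
    constructor
    · intro hV i j
      rw [symPart_self hV]
    · intro hV
      have hV' : symPart V V = 1 := Matrix.ext hV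
      have : symPart V V = (mat V)ᵀ * mat V := by
        rw [symPart, Matrix.transpose_mul, Matrix.transpose_transpose, ← two_smul ℝ, smul_smul]
        norm_num
      change (mat V)ᵀ * mat V = 1
      rw [← this, hV']
  rw [h]
  refine isClosed_iInter fun i => isClosed_iInter fun j => ?_
  have hc : Continuous fun V : Mat p d => symPart V V i j := continuous_iff_continuousAt.2
    fun V => (contDiffAt_symPart_apply (n := 0) contDiffAt_id contDiffAt_id i j).continuousAt
  exact isClosed_eq hc continuous_const

lemma isCompact_stiefel : IsCompact (stiefel p d) := by
  refine Metric.isCompact_of_isClosed_isBounded isClosed_stiefel ?_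
  refine (Metric.isBounded_closedBall (x := (0 : Mat p d)) (r := Real.sqrt d)).subset ?_
  intro V hV
  rw [mem_closedBall_zero_iff, ← norm_sq_of_mem_stiefel hV, Real.sqrt_sq (norm_nonneg _)]

end Smooth

/-! ### Second-order expansions -/

/-- Strict differentiability of `DL` at `a` controls `DL z - DL x - H(z - x)` for all pairs near
`a`, and the mean value inequality integrates this. The expansion has a moving base point but a
frozen Hessian, because later it is based at the iterates while spectral information is available
only at `a`. -/
lemma exists_taylor_two_uniform {E : Type*} [NormedAddCommGroup E] [NormedSpace ℝ E] {L : E → ℝ}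
    {a : E} (hL : ContDiffAt ℝ 2 L a) {ε : ℝ} (hε : 0 < ε) :
    ∃ δ > 0, ∀ x ∈ Metric.ball a δ, ∀ y ∈ Metric.ball a δ,
      |L y - L x - fderiv ℝ L x (y - x) - 1 / 2 * fderiv ℝ (fderiv ℝ L) a (y - x) (y - x)| ≤
        ε * ‖y - x‖ ^ 2 := by
  have hD : ContDiffAt ℝ 1 (fderiv ℝ L) a := hL.fderiv_right (by norm_num)
  have hS := (hD.hasStrictFDerivAt one_ne_zero).isLittleO.def hε
  have hd : ∀ᶠ x in 𝓝 a, DifferentiableAt ℝ L x :=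
    (hL.eventually (by simp)).mono fun x hx => hx.differentiableAt (by norm_num)
  have hsymm : IsSymmSndFDerivAt ℝ L a := hL.isSymmSndFDerivAt (by simp)
  rw [nhds_prod_eq] at hS
  obtain ⟨t, ht, hS⟩ := eventually_prod_self_iff'.1 hS
  obtain ⟨δ, hδ, hball⟩ := Metric.eventually_nhds_iff_ball.1 (hd.and ht)
  refine ⟨δ, hδ, fun x hx y hy => ?_⟩
  set H := fderiv ℝ (fderiv ℝ L) a with hH
  let φ : E → ℝ := fun z => L z - fderiv ℝ L x (z - x) - 1 / 2 * H (z - x) (z - x)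
  have hseg : segment ℝ x y ⊆ Metric.ball a δ := (convex_ball a δ).segment_subset hx hy
  have hφ : ∀ z ∈ segment ℝ x y,
      HasFDerivWithinAt φ (fderiv ℝ L z - fderiv ℝ L x - H (z - x)) (segment ℝ x y) z := by
    intro z hz
    have h1 : HasFDerivAt (fun z : E => z - x) (ContinuousLinearMap.id ℝ E) z :=
      (hasFDerivAt_id z).sub_const x
    have h2 : HasFDerivAt (fun z : E => H (z - x) (z - x)) _ z :=
      (H.hasFDerivAt.comp z h1).clm_apply h1
    have h3 := (((hball z (hseg hz)).1.hasFDerivAt.sub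
      ((fderiv ℝ L x).hasFDerivAt.comp z h1)).sub (h2.const_mul (1 / 2))).hasFDerivWithinAt
        (s := segment ℝ x y)
    refine h3.congr_fderiv ?_
    ext v
    -- Symmetry of the second derivative merges the two terms from differentiating the quadratic
    -- part, cancelling the factor 1/2.
    have hs : H v (z - x) = H (z - x) v := hsymm v (z - x)
    simp only [map_sub, sub_apply] at hs
    simp
    linarith
  have hb : ∀ z ∈ segment ℝ x y,
      ‖fderiv ℝ L z - fderiv ℝ L x - H (z - x)‖ ≤ ε * ‖y - x‖ := by
    intro z hz
    have hz1 := hS z (hball z (hseg hz)).2 x (hball x hx).2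
    refine hz1.trans (mul_le_mul_of_nonneg_left ?_ hε.le)
    obtain ⟨θ, hθ, rfl⟩ := (segment_eq_image' ℝ x y) ▸ hz
    simp only [add_sub_cancel_left, norm_smul, Real.norm_of_nonneg hθ.1]
    exact mul_le_of_le_one_left (norm_nonneg _) hθ.2
  have h := (convex_segment x y).norm_image_sub_le_of_norm_hasFDerivWithin_le hφ hb
    (left_mem_segment ℝ x y) (right_mem_segment ℝ x y)
  simp only [φ, sub_self, map_zero, mul_zero, sub_zero, Real.norm_eq_abs] at h
  rw [pow_two, ← mul_assoc]
  convert h using 2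
  ring

lemma eventually_norm_fderiv_sub_le {E : Type*} [NormedAddCommGroup E] [NormedSpace ℝ E]
    {L : E → ℝ} {a : E} (hL : ContDiffAt ℝ 2 L a) {ε : ℝ} (hε : 0 < ε) :
    ∀ᶠ x in 𝓝 a, ‖fderiv ℝ L x - fderiv ℝ L a - fderiv ℝ (fderiv ℝ L) a (x - a)‖ ≤
      ε * ‖x - a‖ := by
  have hD : ContDiffAt ℝ 1 (fderiv ℝ L) a := hL.fderiv_right (by norm_num)
  exact (hD.differentiableAt one_ne_zero).hasFDerivAt.isLittleO.def hε

/-- A quadratic form bounded below by `l` and above by `u` on a set `T` satisfies almost the same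
bounds at vectors close to `T`. -/
lemma exists_quadratic_bounds {E : Type*} [NormedAddCommGroup E] [NormedSpace ℝ E]
    (H : E →L[ℝ] E →L[ℝ] ℝ) {T : Set E} {l u : ℝ} (hl : 0 < l) (hlu : l ≤ u)
    (hT : ∀ ζ ∈ T, l * ‖ζ‖ ^ 2 ≤ H ζ ζ ∧ H ζ ζ ≤ u * ‖ζ‖ ^ 2) {ε : ℝ} (hε : 0 < ε) :
    ∃ η > 0, ∀ ξ w ζ : E, ζ ∈ T → ‖w - ξ‖ ≤ η * ‖ξ‖ → ‖ζ - ξ‖ ≤ η * ‖ξ‖ →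
      (l - ε) * ‖ξ‖ ^ 2 ≤ H w w ∧ H w w ≤ (u + ε) * ‖ξ‖ ^ 2 := by
  have hu : 0 < u := hl.trans_le hlu
  have hM : 0 < 8 * ‖H‖ + 3 * u + 1 := by positivity
  -- `8‖H‖` pays for replacing `w` by `ζ` in the form, `3u` for replacing `‖ζ‖²` by `‖ξ‖²`; the 1
  -- keeps the denominator positive.
  refine ⟨min 1 (ε / (8 * ‖H‖ + 3 * u + 1)), lt_min one_pos (by positivity), ?_⟩
  generalize hη : min 1 (ε / (8 * ‖H‖ + 3 * u + 1)) = η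
  have hη0 : 0 < η := by rw [← hη]; exact lt_min one_pos (by positivity)
  have hη1 : η ≤ 1 := by rw [← hη]; exact min_le_left _ _
  have hηε : (8 * ‖H‖ + 3 * u + 1) * η ≤ ε := by
    rw [← hη, ← le_div_iff₀' hM]; exact min_le_right _ _
  intro ξ w ζ hζ hw hζξ
  obtain ⟨h1, h2⟩ := hT ζ hζ
  have hn := norm_nonneg ξ
  have hηξ : η * ‖ξ‖ ≤ ‖ξ‖ := mul_le_of_le_one_left hn hη1
  have hw2 : ‖w‖ ≤ 2 * ‖ξ‖ := by
    have := norm_add_le (w - ξ) ξ; rw [sub_add_cancel] at this; linarith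
  have hζ2 : ‖ζ‖ ≤ ‖ξ‖ + η * ‖ξ‖ := by
    have := norm_add_le (ζ - ξ) ξ; rw [sub_add_cancel] at this; linarith
  have hζ3 : ‖ξ‖ - η * ‖ξ‖ ≤ ‖ζ‖ := by
    have := norm_sub_le ζ (ζ - ξ); rw [sub_sub_cancel] at this; linarith
  have hwζ : ‖w - ζ‖ ≤ 2 * (η * ‖ξ‖) := by
    have := norm_sub_le (w - ξ) (ζ - ξ); rw [sub_sub_sub_cancel_right] at this; linarith
  have hdiff : |H w w - H ζ ζ| ≤ 8 * ‖H‖ * η * ‖ξ‖ ^ 2 := by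
    have he : H w w - H ζ ζ = H (w - ζ) w + H ζ (w - ζ) := by simp
    have e1 : ‖H (w - ζ) w‖ ≤ ‖H‖ * (2 * (η * ‖ξ‖)) * (2 * ‖ξ‖) :=
      (H.le_opNorm₂ _ _).trans (by gcongr)
    have e2 : ‖H ζ (w - ζ)‖ ≤ ‖H‖ * (2 * ‖ξ‖) * (2 * (η * ‖ξ‖)) :=
      (H.le_opNorm₂ _ _).trans (by gcongr; linarith)
    rw [he]
    refine (abs_add_le _ _).trans ?_
    rw [Real.norm_eq_abs] at e1 e2
    nlinarith
  have hsq1 : ‖ζ‖ ^ 2 ≤ (1 + 3 * η) * ‖ξ‖ ^ 2 := by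
    have : ‖ζ‖ ^ 2 ≤ (‖ξ‖ + η * ‖ξ‖) ^ 2 := by gcongr
    nlinarith [mul_nonneg (mul_nonneg hη0.le (sub_nonneg.2 hη1)) (sq_nonneg ‖ξ‖)]
  have hsq2 : (1 - 3 * η) * ‖ξ‖ ^ 2 ≤ ‖ζ‖ ^ 2 := by
    have : (‖ξ‖ - η * ‖ξ‖) ^ 2 ≤ ‖ζ‖ ^ 2 := by
      have : 0 ≤ ‖ξ‖ - η * ‖ξ‖ := by linarith
      gcongr
    nlinarith [mul_nonneg hη0.le (sq_nonneg ‖ξ‖), mul_nonneg (sq_nonneg η) (sq_nonneg ‖ξ‖)]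
  have hfin : (8 * ‖H‖ + 3 * u + 1) * η * ‖ξ‖ ^ 2 ≤ ε * ‖ξ‖ ^ 2 := by gcongr
  have hx := mul_nonneg hη0.le (sq_nonneg ‖ξ‖)
  obtain ⟨d1, d2⟩ := abs_le.1 hdiff
  constructor
  · have h5 := mul_le_mul_of_nonneg_left hsq2 hl.le
    have h6 := mul_le_mul_of_nonneg_right hlu hx
    nlinarith
  · have h5 := mul_le_mul_of_nonneg_left hsq1 (hl.le.trans hlu)
    nlinarith

/-! ### First-order behaviour of retractions -/

section

variable {p d : ℕ}

lemma smul_mem_tangentSpace {V ξ : Mat p d} (hξ : ξ ∈ tangentSpace V) (t : ℝ) :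
    t • ξ ∈ tangentSpace V := (tangentSubmodule V).smul_mem t hξ

/-- The ray `t ↦ (x, tξ)` stays in the tangent bundle, and `R` along it has velocity exactly `ξ` at
`t = 0`. Continuity of the derivative at `(a, 0)` keeps the velocity near `ξ`, uniformly in `x`, and
the mean value inequality concludes. -/
lemma IsRetraction.exists_norm_sub_le {R : Mat p d → Mat p d → Mat p d} (hR : IsRetraction R)
    {a : Mat p d} (ha : a ∈ stiefel p d) {ε : ℝ} (hε : 0 < ε) :
    ∃ δ > 0, ∀ x ∈ stiefel p d, ‖x - a‖ < δ → ∀ ξ ∈ tangentSpace x, ‖ξ‖ < δ →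
      ‖R x ξ - x - ξ‖ ≤ ε * ‖ξ‖ := by
  have hz : ((a, 0) : Mat p d × Mat p d) ∈ tangentBundle p d :=
    ⟨ha, (tangentSubmodule a).zero_mem⟩
  have hs : ContDiffWithinAt ℝ (0 + 1) (fun q : Mat p d × Mat p d => R q.1 q.2)
      (tangentBundle p d) (a, 0) := (hR.smooth _ hz).of_le (by norm_num)
  -- Derivatives within the tangent bundle need not be unique, so one continuous choice `A` is
  -- fixed; only its values along the rays are used.
  obtain ⟨w, hw, -, -, A, hA, hAc⟩ :=
    (contDiffWithinAt_succ_iff_hasFDerivWithinAt' (by norm_num)).1 hs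
  rw [Set.insert_eq_of_mem hz] at hw
  have hev : ∀ᶠ q in 𝓝[tangentBundle p d] ((a, 0) : Mat p d × Mat p d),
      q ∈ w ∧ dist (A q) (A (a, 0)) < ε / 2 :=
    (show ∀ᶠ q in _, q ∈ w from hw).and
      (Metric.tendsto_nhds.1 hAc.continuousWithinAt (ε / 2) (by positivity))
  obtain ⟨δ, hδ, hball⟩ := Metric.mem_nhdsWithin_iff.1 hev
  refine ⟨δ, hδ, fun x hx hxa ξ hξ hξδ => ?_⟩
  have hq : ∀ t ∈ Set.Icc (0 : ℝ) 1, ((x, t • ξ) : Mat p d × Mat p d) ∈ w ∧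
      dist (A (x, t • ξ)) (A (a, 0)) < ε / 2 := by
    intro t ht
    refine hball ⟨?_, hx, smul_mem_tangentSpace hξ t⟩
    rw [Metric.mem_ball, Prod.dist_eq, max_lt_iff, dist_eq_norm, dist_eq_norm, sub_zero, norm_smul,
      Real.norm_of_nonneg ht.1]
    exact ⟨hxa, (mul_le_of_le_one_left (norm_nonneg _) ht.2).trans_lt hξδ⟩
  have hder : ∀ t ∈ Set.Icc (0 : ℝ) 1, HasDerivWithinAt (fun t : ℝ => R x (t • ξ))
      (A (x, t • ξ) (0, ξ)) (Set.Icc 0 1) t := by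
    intro t ht
    have h1 : HasDerivWithinAt (fun t : ℝ => ((x, t • ξ) : Mat p d × Mat p d)) (0, ξ)
        (Set.Icc 0 1) t := by
      have h2 : HasDerivWithinAt (fun t : ℝ => t • ξ) ξ (Set.Icc 0 1) t := by
        simpa using (hasDerivWithinAt_id t (Set.Icc (0 : ℝ) 1)).smul_const ξ
      exact (hasDerivWithinAt_const t (Set.Icc (0 : ℝ) 1) x).prodMk h2
    have hmaps : Set.MapsTo (fun t : ℝ => ((x, t • ξ) : Mat p d × Mat p d)) (Set.Icc 0 1)
        (tangentBundle p d) := fun s _ => ⟨hx, smul_mem_tangentSpace hξ s⟩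
    exact (hA _ (hq t ht).1).comp_hasDerivWithinAt t h1 hmaps
  have h0 : A (x, (0 : ℝ) • ξ) (0, ξ) = ξ :=
    (uniqueDiffOn_Icc (zero_lt_one' ℝ) 0 (by simp)).eq_deriv _ (hder 0 (by simp))
      (hR.deriv_zero x hx ξ hξ).hasDerivWithinAt
  have hder' : ∀ t ∈ Set.Icc (0 : ℝ) 1, HasDerivWithinAt (fun t : ℝ => R x (t • ξ) - t • ξ)
      (A (x, t • ξ) (0, ξ) - ξ) (Set.Icc 0 1) t := by
    intro t ht
    have h2 : HasDerivWithinAt (fun t : ℝ => t • ξ) ξ (Set.Icc 0 1) t := by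
      simpa using (hasDerivWithinAt_id t (Set.Icc (0 : ℝ) 1)).smul_const ξ
    exact (hder t ht).sub h2
  have hbound : ∀ t ∈ Set.Ico (0 : ℝ) 1, ‖A (x, t • ξ) (0, ξ) - ξ‖ ≤ ε * ‖ξ‖ := by
    intro t ht
    have h1 := (hq t ⟨ht.1, ht.2.le⟩).2
    have h2 := (hq 0 (by simp)).2
    have h3 : ‖A (x, t • ξ) - A (x, (0 : ℝ) • ξ)‖ ≤ ε := by
      rw [← dist_eq_norm]
      linarith [dist_triangle_right (A (x, t • ξ)) (A (x, (0 : ℝ) • ξ)) (A (a, 0))]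
    have h4 : A (x, t • ξ) (0, ξ) - ξ = (A (x, t • ξ) - A (x, (0 : ℝ) • ξ)) (0, ξ) := by
      rw [sub_apply, h0]
    rw [h4]
    refine (ContinuousLinearMap.le_opNorm _ _).trans ?_
    have h5 : ‖((0 : Mat p d), ξ)‖ = ‖ξ‖ := by simp [Prod.norm_def]
    rw [h5]
    gcongr
  have h := norm_image_sub_le_of_norm_deriv_le_segment_01' hder' hbound
  simp only [one_smul, zero_smul, sub_zero, hR.map_zero x hx] at h
  rwa [sub_right_comm]

/-! ### Armijo steps along the negative gradient -/

/-- Minimality of the exponent enters only through the trial just before the accepted one: `s = t /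
β` was rejected, unless no backtracking occurred. -/
lemma IsArmijoStep.spec {f : Mat p d → ℝ} {R : Mat p d → Mat p d → Mat p d} {abar β σ t : ℝ}
    {V : Mat p d} (habar : 0 < abar) (hβ : β ∈ Set.Ioo (0 : ℝ) 1)
    (h : IsArmijoStep f R abar β σ V (-rgrad f V) t) :
    0 < t ∧ σ * t * ‖rgrad f V‖ ^ 2 ≤ f V - f (R V (t • -rgrad f V)) ∧
    (t = abar ∨ ∃ s, 0 < s ∧ s ≤ abar ∧ t = β * s ∧
      f V - f (R V (s • -rgrad f V)) < σ * s * ‖rgrad f V‖ ^ 2) := by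
  have hin : ∀ s : ℝ, -σ * inner ℝ (rgrad f V) (s • -rgrad f V) = σ * s * ‖rgrad f V‖ ^ 2 := by
    intro s
    rw [real_inner_smul_right, inner_neg_right, real_inner_self_eq_norm_sq]
    ring
  obtain ⟨m, ⟨hm, hleast⟩, rfl⟩ := h
  have hm' : f V - f (R V ((β ^ m * abar) • -rgrad f V)) ≥
      -σ * inner ℝ (rgrad f V) ((β ^ m * abar) • -rgrad f V) := hm
  have hpos : ∀ n : ℕ, 0 < β ^ n * abar := fun n => mul_pos (pow_pos hβ.1 n) habar
  refine ⟨hpos m, by rw [← hin]; exact hm', ?_⟩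
  rcases m with _ | n
  · left; simp
  · right
    refine ⟨β ^ n * abar, hpos n, ?_, by ring, ?_⟩
    · exact mul_le_of_le_one_left habar.le (pow_le_one₀ hβ.1.le hβ.2.le)
    · by_contra hcon
      rw [not_lt, ← hin] at hcon
      have := hleast (show n ∈ {m : ℕ | f V - f (R V ((β ^ m * abar) • -rgrad f V)) ≥
        -σ * inner ℝ (rgrad f V) ((β ^ m * abar) • -rgrad f V)} from hcon)
      omega

end

/-! ### Smoothness of the loss near the Stiefel manifold -/

section MatrixSmooth

variable {F : Type*} [NormedAddCommGroup F] [NormedSpace ℝ F] {n : WithTop ℕ∞} {x : F}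
  {k l m : Type*}

/-- A matrix-valued map all of whose entries are `C^n` at `x`. -/
def EntrywiseContDiffAt (n : WithTop ℕ∞) (M : F → Matrix k l ℝ) (x : F) : Prop :=
  ∀ i j, ContDiffAt ℝ n (fun y => M y i j) x

lemma EntrywiseContDiffAt.const (M : Matrix k l ℝ) : EntrywiseContDiffAt n (fun _ => M) x :=
  fun _ _ => contDiffAt_const

lemma EntrywiseContDiffAt.transpose {M : F → Matrix k l ℝ} (hM : EntrywiseContDiffAt n M x) :
    EntrywiseContDiffAt n (fun y => (M y)ᵀ) x := fun i j => hM j i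

lemma EntrywiseContDiffAt.mul [Fintype l] {M : F → Matrix k l ℝ} {N : F → Matrix l m ℝ}
    (hM : EntrywiseContDiffAt n M x) (hN : EntrywiseContDiffAt n N x) :
    EntrywiseContDiffAt n (fun y => M y * N y) x := by
  intro i j
  simp only [Matrix.mul_apply]
  exact ContDiffAt.sum fun t _ => (hM i t).mul (hN t j)

lemma EntrywiseContDiffAt.trace [Fintype k] {M : F → Matrix k k ℝ}
    (hM : EntrywiseContDiffAt n M x) : ContDiffAt ℝ n (fun y => (M y).trace) x := by
  simp only [Matrix.trace, Matrix.diag_apply]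
  exact ContDiffAt.sum fun t _ => hM t t

variable [Fintype k] [DecidableEq k]

lemma EntrywiseContDiffAt.det {M : F → Matrix k k ℝ} (hM : EntrywiseContDiffAt n M x) :
    ContDiffAt ℝ n (fun y => (M y).det) x := by
  simp only [Matrix.det_apply']
  exact ContDiffAt.sum fun s _ => contDiffAt_const.mul (contDiffAt_prod fun i _ => hM (s i) i)

/-- Cramer's rule: adjugate entries are determinants of the matrix with one row replaced by a
constant. -/
lemma EntrywiseContDiffAt.inv {M : F → Matrix k k ℝ} (hM : EntrywiseContDiffAt n M x)
    (hx : (M x).det ≠ 0) : EntrywiseContDiffAt n (fun y => (M y)⁻¹) x := by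
  intro i j
  simp only [Matrix.inv_def, Ring.inverse_eq_inv', Matrix.smul_apply, smul_eq_mul,
    Matrix.adjugate_apply]
  refine (hM.det.inv hx).mul (EntrywiseContDiffAt.det fun a b => ?_)
  by_cases hab : a = j
  · subst hab
    simp only [Matrix.updateRow_self]
    exact contDiffAt_const
  · simp only [Matrix.updateRow_ne hab]
    exact hM a b

end MatrixSmooth

section Loss

variable {p d : ℕ}

lemma entrywiseContDiffAt_mat {n : WithTop ℕ∞} (V : Mat p d) :
    EntrywiseContDiffAt n (fun W : Mat p d => mat W) V :=
  fun i j => contDiffAt_euclidean.1 contDiffAt_id (i, j)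

lemma mulVec_injective_of_posDef {S : Matrix (Fin p) (Fin p) ℝ} (hS : S.PosDef) {V : Mat p d}
    (hV : V ∈ stiefel p d) : Function.Injective (S * mat V).mulVec := by
  have h : (mat V)ᵀ * mat V = 1 := hV
  have hdet : IsUnit S.det := hS.det_pos.ne'.isUnit
  have hleft : ((mat V)ᵀ * S⁻¹) * (S * mat V) = 1 := by
    rw [Matrix.mul_assoc, ← Matrix.mul_assoc S⁻¹, Matrix.nonsing_inv_mul _ hdet, Matrix.one_mul, h]
  intro a b hab
  have := congrArg ((mat V)ᵀ * S⁻¹).mulVec hab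
  simpa only [Matrix.mulVec_mulVec, hleft, Matrix.one_mulVec] using this

lemma det_gram_ne_zero {S : Matrix (Fin p) (Fin p) ℝ} (hS : S.PosDef) {V : Mat p d}
    (hV : V ∈ stiefel p d) : ((S * mat V)ᵀ * (S * mat V)).det ≠ 0 := by
  have h := Matrix.PosDef.conjTranspose_mul_self _ (mulVec_injective_of_posDef hS hV)
  rw [Matrix.conjTranspose_eq_transpose_of_trivial] at h
  exact h.det_pos.ne'

/-- Since `S` is symmetric, the inverted matrix `Vᵀ S² V` is the Gram matrix of `S V`, which has
full column rank. -/
lemma contDiffAt_traceTerm {n : WithTop ℕ∞} {S : Matrix (Fin p) (Fin p) ℝ} (hS : S.PosDef)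
    (A : Matrix (Fin p) (Fin p) ℝ) {V : Mat p d} (hV : V ∈ stiefel p d) :
    ContDiffAt ℝ n (traceTerm S A) V := by
  have hSt : Sᵀ = S := by
    rw [← Matrix.conjTranspose_eq_transpose_of_trivial]
    exact hS.isHermitian
  have hdet : ((mat V)ᵀ * S ^ 2 * mat V).det ≠ 0 := by
    have := det_gram_ne_zero hS hV
    rwa [Matrix.transpose_mul, hSt, Matrix.mul_assoc, ← Matrix.mul_assoc S, ← pow_two,
      ← Matrix.mul_assoc] at this
  have hm := entrywiseContDiffAt_mat (n := n) V
  exact (((hm.transpose.mul (.const _)).mul hm).mul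
    (((hm.transpose.mul (.const _)).mul hm).inv hdet)).trace

/-! ### Column-space projections and the population loss. -/

/-- The matrix of the orthogonal projection onto the column space of `W`, for `W` of full rank. -/
def colProj (W : Matrix (Fin p) (Fin d) ℝ) : Matrix (Fin p) (Fin p) ℝ :=
  W * (Wᵀ * W)⁻¹ * Wᵀ

lemma mem_colSpace_mulVec (W : Matrix (Fin p) (Fin d) ℝ) (a : Fin d → ℝ) :
    WithLp.toLp 2 (W *ᵥ a) ∈ colSpace W := by
  have h : WithLp.toLp 2 (W *ᵥ a) =
      ∑ j, a j • (WithLp.toLp 2 fun i => W i j : EuclideanSpace ℝ (Fin p)) := by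
    ext i
    simp [Matrix.mulVec, dotProduct, mul_comm]
  rw [h]
  exact Submodule.sum_mem _ fun j _ => Submodule.smul_mem _ _ (Submodule.subset_span ⟨j, rfl⟩)

/-- The vector `P m` lies in the column space and `Wᵀ` kills `m - P m`, so it is the nearest point;
Pythagoras gives `‖m‖² - ⟨m, P m⟩`. Written in the products `m i * m j`, this separates `W` from `m`
before integration. -/
lemma infDist_colSpace_sq {W : Matrix (Fin p) (Fin d) ℝ} (hW : (Wᵀ * W).det ≠ 0)
    (m : EuclideanSpace ℝ (Fin p)) :
    Metric.infDist m (colSpace W : Set (EuclideanSpace ℝ (Fin p))) ^ 2 =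
      ‖m‖ ^ 2 - ∑ i, ∑ j, colProj W i j * (m i * m j) := by
  set z : EuclideanSpace ℝ (Fin p) := WithLp.toLp 2 (colProj W *ᵥ m.ofLp) with hz
  have hzmem : z ∈ colSpace W := by
    rw [hz, colProj, Matrix.mul_assoc, ← Matrix.mulVec_mulVec]
    exact mem_colSpace_mulVec _ _
  have hkey : Wᵀ *ᵥ (m.ofLp - colProj W *ᵥ m.ofLp) = 0 := by
    rw [Matrix.mulVec_sub, Matrix.mulVec_mulVec, colProj, ← Matrix.mul_assoc, ← Matrix.mul_assoc,
      Matrix.mul_nonsing_inv _ hW.isUnit, Matrix.one_mul, sub_self]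
  have horth : m - z ∈ (colSpace W)ᗮ := by
    rw [Submodule.mem_orthogonal]
    intro w hw
    induction hw using Submodule.span_induction with
    | mem w hw =>
      obtain ⟨j, rfl⟩ := hw
      have := congrFun hkey j
      simpa [PiLp.inner_apply, Matrix.mulVec, dotProduct, hz, mul_comm] using this
    | zero => simp
    | add a b _ _ ha hb => rw [inner_add_left, ha, hb, add_zero]
    | smul c a _ ha => rw [inner_smul_left, ha, mul_zero]
  have hproj : (colSpace W).starProjection m = z :=
    Submodule.eq_starProjection_of_mem_orthogonal hzmem horth
  have hdist : Metric.infDist m (colSpace W : Set (EuclideanSpace ℝ (Fin p))) = ‖m - z‖ := by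
    rw [← hproj, Submodule.starProjection_minimal, Metric.infDist_eq_iInf]
    simp only [dist_eq_norm]
    rfl
  have hzz : inner ℝ z (m - z) = 0 := (Submodule.mem_orthogonal _ _).1 horth z hzmem
  have hmz : inner ℝ m z = ∑ i, ∑ j, colProj W i j * (m i * m j) := by
    rw [PiLp.inner_apply]
    simp only [hz, Matrix.mulVec, dotProduct, RCLike.inner_apply, conj_trivial, Finset.sum_mul]
    refine Finset.sum_congr rfl fun i _ => Finset.sum_congr rfl fun j _ => by ring
  rw [hdist, ← hmz, ← real_inner_self_eq_norm_sq, ← real_inner_self_eq_norm_sq, inner_sub_left,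
    hzz, inner_sub_right, sub_zero]

/-- Conditional expectation preserves `L²`, so the second moments of `E[x | y]` are finite. The loss
is then a constant minus a fixed linear function of the projection matrix of `Σ_xx V`, which depends
smoothly on `V`. -/
lemma contDiffAt_invRegLoss {n : WithTop ℕ∞} {Ω : Type u} [MeasurableSpace Ω] {μ : Measure Ω}
    [IsProbabilityMeasure μ] {x : Ω → EuclideanSpace ℝ (Fin p)} {y : Ω → ℝ} (hx : MemLp x 2 μ)
    (hcov : (covMatrix μ x).PosDef) {V : Mat p d} (hV : V ∈ stiefel p d) :
    ContDiffAt ℝ n (invRegLoss μ x y) V := by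
  set m : Ω → EuclideanSpace ℝ (Fin p) := μ[x | MeasurableSpace.comap y inferInstance] with hm
  set S := covMatrix μ x with hS
  have hmL : MemLp m 2 μ := hx.condExp (by norm_num)
  have hmi : ∀ i, MemLp (fun ω => m ω i) 2 μ := fun i =>
    (EuclideanSpace.proj (𝕜 := ℝ) i : EuclideanSpace ℝ (Fin p) →L[ℝ] ℝ).comp_memLp' hmL
  have hint : ∀ i j, Integrable (fun ω => m ω i * m ω j) μ := fun i j =>
    (hmi i).integrable_mul (hmi j)
  have hsq : Integrable (fun ω => ‖m ω‖ ^ 2) μ := hmL.integrable_norm_pow two_ne_zero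
  have hI : ∀ Q : Fin p → Fin p → ℝ,
      ∫ ω, (‖m ω‖ ^ 2 - ∑ i, ∑ j, Q i j * (m ω i * m ω j)) ∂μ =
        (∫ ω, ‖m ω‖ ^ 2 ∂μ) - ∑ i, ∑ j, Q i j * ∫ ω, m ω i * m ω j ∂μ := by
    intro Q
    have hj : ∀ i j, Integrable (fun ω => Q i j * (m ω i * m ω j)) μ := fun i j =>
      (hint i j).const_mul _
    have hi : ∀ i, Integrable (fun ω => ∑ j, Q i j * (m ω i * m ω j)) μ := fun i =>
      integrable_finsetSum _ fun j _ => hj i j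
    rw [integral_sub hsq (integrable_finsetSum _ fun i _ => hi i),
      integral_finsetSum _ fun i _ => hi i]
    congr 1
    refine Finset.sum_congr rfl fun i _ => ?_
    rw [integral_finsetSum _ fun j _ => hj i j]
    exact Finset.sum_congr rfl fun j _ => integral_const_mul _ _
  have hW : EntrywiseContDiffAt n (fun W : Mat p d => S * mat W) V :=
    (EntrywiseContDiffAt.const S).mul (entrywiseContDiffAt_mat V)
  have hW0 : EntrywiseContDiffAt 0 (fun W : Mat p d => S * mat W) V :=
    (EntrywiseContDiffAt.const S).mul (entrywiseContDiffAt_mat V)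
  have hdet := det_gram_ne_zero hcov hV
  -- Ambient smoothness needs the formula off the manifold too; full rank is an open condition.
  have hev : ∀ᶠ W in 𝓝 V, ((S * mat W)ᵀ * (S * mat W)).det ≠ 0 :=
    (hW0.transpose.mul hW0).det.continuousAt.eventually_ne hdet
  have heq : ∀ᶠ W in 𝓝 V, invRegLoss μ x y W = (∫ ω, ‖m ω‖ ^ 2 ∂μ) -
      ∑ i, ∑ j, colProj (S * mat W) i j * ∫ ω, m ω i * m ω j ∂μ := by
    filter_upwards [hev] with W hWdet
    have hpt : invRegLoss μ x y W = ∫ ω, (‖m ω‖ ^ 2 -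
        ∑ i, ∑ j, colProj (S * mat W) i j * (m ω i * m ω j)) ∂μ :=
      integral_congr_ae (.of_forall fun ω => infDist_colSpace_sq hWdet (m ω))
    exact hpt.trans (hI (colProj (S * mat W)))
  refine ContDiffAt.congr_of_eventuallyEq ?_ heq
  have hP : EntrywiseContDiffAt n (fun W : Mat p d => colProj (S * mat W)) V :=
    (hW.mul ((hW.transpose.mul hW).inv hdet)).mul hW.transpose
  exact contDiffAt_const.sub (ContDiffAt.sum fun i _ => ContDiffAt.sum fun j _ =>
    (hP i j).mul contDiffAt_const)

lemma IsCIRLoss.contDiffAt {n : WithTop ℕ∞} {f : Mat p d → ℝ} (hf : IsCIRLoss.{u, v} p d f)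
    {V : Mat p d} (hV : V ∈ stiefel p d) : ContDiffAt ℝ n f V := by
  cases hf with
  | population μ μ' x y x' y' α hx hx' hy hy' hx0 hx0' hcov hcov' hα =>
    exact (contDiffAt_invRegLoss hx hcov hV).sub
      (contDiffAt_const.mul (contDiffAt_invRegLoss hx' hcov' hV))
  | sample X Y I X' Y' I' α hI hI' hcov hcov' hα =>
    exact (contDiffAt_traceTerm hcov _ hV).neg.add
      (contDiffAt_const.mul (contDiffAt_traceTerm hcov' _ hV))

end Loss

section

variable {p d : ℕ} {f : Mat p d → ℝ} {R : Mat p d → Mat p d → Mat p d} {abar β σ c : ℝ}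
  {V : ℕ → Mat p d}

/-! ### The Riemannian gradient -/

lemma inner_gradient_eq_fderiv (f : Mat p d → ℝ) (x v : Mat p d) :
    inner ℝ (gradient f x) v = fderiv ℝ f x v := by
  simp [gradient]

lemma contDiffAt_gradient {a : Mat p d} (hf : ContDiffAt ℝ 2 f a) :
    ContDiffAt ℝ 1 (gradient f) a := by
  have hD : ContDiffAt ℝ 1 (fderiv ℝ f) a := hf.fderiv_right (by norm_num)
  exact (InnerProductSpace.toDual ℝ (Mat p d)).symm.contDiff.contDiffAt.comp a hD

lemma rgrad_mem {x : Mat p d} (hx : x ∈ stiefel p d) : rgrad f x ∈ tangentSpace x :=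
  proj_mem hx _

lemma inner_rgrad {x ξ : Mat p d} (hξ : ξ ∈ tangentSpace x) :
    inner ℝ (rgrad f x) ξ = fderiv ℝ f x ξ := by
  rw [rgrad, inner_proj_left hξ, inner_gradient_eq_fderiv]

lemma contDiffAt_rgrad {a : Mat p d} (hf : ContDiffAt ℝ 2 f a) : ContDiffAt ℝ 1 (rgrad f) a :=
  contDiffAt_proj contDiffAt_id (contDiffAt_gradient hf)

/-! ### Global convergence of the line search -/

/-- Near a noncritical point the decrease guaranteed by an Armijo step is bounded below. -/
lemma exists_armijo_decrease_lower_bound (hR : IsRetraction R) (habar : 0 < abar)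
    (hβ : β ∈ Set.Ioo (0 : ℝ) 1) (hσ : σ ∈ Set.Ioo (0 : ℝ) 1) {a : Mat p d}
    (ha : a ∈ stiefel p d) (hf : ContDiffAt ℝ 2 f a) (hg : rgrad f a ≠ 0) :
    ∃ κ > 0, ∀ᶠ x in 𝓝[stiefel p d] a, ∀ t,
      IsArmijoStep f R abar β σ x (-rgrad f x) t → κ ≤ t * ‖rgrad f x‖ ^ 2 := by
  set g₀ := ‖rgrad f a‖ with hg₀
  have hg₀pos : 0 < g₀ := norm_pos_iff.2 hg
  have hσ1 : 0 < 1 - σ := sub_pos.2 hσ.2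
  set M := ‖fderiv ℝ f a‖ with hM
  have hMnn : 0 ≤ M := norm_nonneg _
  -- The errors below total `3ε₁ + M ε₂`. Each summand is at most `(1-σ)g₀/4`, so the total stays
  -- below `(1-σ)‖G‖` once `‖G‖ > g₀/2`.
  obtain ⟨ε₁, hε₁, hε₁eq⟩ : ∃ ε₁ > 0, 12 * ε₁ = (1 - σ) * g₀ :=
    ⟨(1 - σ) * g₀ / 12, by positivity, by ring⟩
  obtain ⟨ε₂, hε₂, hε₂1, hε₂M⟩ : ∃ ε₂ > 0, ε₂ ≤ 1 ∧ 4 * (M * ε₂) ≤ (1 - σ) * g₀ := by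
    refine ⟨min 1 ((1 - σ) * g₀ / (4 * (M + 1))), lt_min one_pos (by positivity),
      min_le_left _ _, ?_⟩
    have h := min_le_right 1 ((1 - σ) * g₀ / (4 * (M + 1)))
    have h0 : 0 ≤ min 1 ((1 - σ) * g₀ / (4 * (M + 1))) := le_min zero_le_one (by positivity)
    rw [le_div_iff₀ (by positivity)] at h
    nlinarith
  obtain ⟨δ₂, hδ₂, hret⟩ := hR.exists_norm_sub_le ha hε₂
  have hS := (hf.hasStrictFDerivAt two_ne_zero).isLittleO.def hε₁
  rw [nhds_prod_eq] at hS
  obtain ⟨w, hw, hS⟩ := eventually_prod_self_iff'.1 hS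
  obtain ⟨δ₁, hδ₁, hball⟩ := Metric.mem_nhds_iff.1 hw
  have hDc : ∀ᶠ x in 𝓝 a, dist (fderiv ℝ f x) (fderiv ℝ f a) < ε₁ :=
    Metric.tendsto_nhds.1 (hf.continuousAt_fderiv two_ne_zero) ε₁ hε₁
  have hGc : ∀ᶠ x in 𝓝 a, g₀ / 2 < ‖rgrad f x‖ :=
    (contDiffAt_rgrad hf).continuousAt.norm.eventually_const_lt (by linarith)
  obtain ⟨δ, hδ, hδ1, hδ2⟩ : ∃ δ > 0, 3 * δ ≤ δ₁ ∧ δ ≤ δ₂ :=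
    ⟨min (δ₁ / 3) δ₂, lt_min (by positivity) hδ₂, by linarith [min_le_left (δ₁ / 3) δ₂],
      min_le_right _ _⟩
  refine ⟨min (abar * (g₀ / 2) ^ 2) (β * δ * (g₀ / 2)),
    lt_min (by positivity) (by have := hβ.1; positivity), ?_⟩
  filter_upwards [self_mem_nhdsWithin, mem_nhdsWithin_of_mem_nhds hDc,
    mem_nhdsWithin_of_mem_nhds hGc, mem_nhdsWithin_of_mem_nhds (Metric.ball_mem_nhds a hδ)]
    with x hx hxD hxG hxa t ht
  rw [mem_ball_iff_norm] at hxa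
  obtain ⟨ht0, -, rfl | ⟨s, hs0, -, rfl, hfail⟩⟩ := ht.spec habar hβ
  · refine (min_le_left _ _).trans ?_
    gcongr
  · refine (min_le_right _ _).trans ?_
    set G := rgrad f x with hG
    have hGT : G ∈ tangentSpace x := rgrad_mem hx
    -- A rejected displacement cannot be shorter than `δ`: otherwise the first-order expansion of
    -- `f` along `R` would satisfy the Armijo test, as `σ < 1`.
    suffices h : δ ≤ s * ‖G‖ by
      calc β * δ * (g₀ / 2) ≤ β * (s * ‖G‖) * ‖G‖ := by
            have := hβ.1
            gcongr
        _ = β * s * ‖G‖ ^ 2 := by ring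
    by_contra! hlt
    set ξ := s • -G with hξ
    have hξn : ‖ξ‖ = s * ‖G‖ := by rw [hξ, norm_smul, norm_neg, Real.norm_of_nonneg hs0.le]
    have hξT : ξ ∈ tangentSpace x := smul_mem_tangentSpace ((tangentSubmodule x).neg_mem hGT) s
    set y := R x ξ with hy
    have hyx : ‖y - x - ξ‖ ≤ ε₂ * ‖ξ‖ :=
      hret x hx (hxa.trans_le hδ2) ξ hξT (by rw [hξn]; linarith)
    have hyx2 : ‖y - x‖ ≤ 2 * ‖ξ‖ := by
      have := norm_add_le (y - x - ξ) ξ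
      rw [sub_add_cancel] at this
      nlinarith [norm_nonneg ξ]
    have hya : ‖y - a‖ < δ₁ := by
      have := norm_add_le (y - x) (x - a)
      rw [sub_add_sub_cancel] at this
      linarith
    have h1 := hS y (hball (mem_ball_iff_norm.2 hya)) x
      (hball (mem_ball_iff_norm.2 (by linarith)))
    rw [Real.norm_eq_abs] at h1
    have h2 := (le_abs_self _).trans h1
    have h3 : fderiv ℝ f a (y - x - ξ) ≤ M * (ε₂ * ‖ξ‖) :=
      (le_abs_self _).trans ((fderiv ℝ f a).le_opNorm_of_le hyx)
    have h4 : -((fderiv ℝ f x - fderiv ℝ f a) ξ) ≤ ε₁ * ‖ξ‖ := by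
      refine (neg_le_abs _).trans (((fderiv ℝ f x - fderiv ℝ f a).le_opNorm ξ).trans ?_)
      rw [dist_eq_norm] at hxD
      gcongr
    have h5 : fderiv ℝ f x ξ = -(s * ‖G‖ ^ 2) := by
      rw [← inner_rgrad hξT, hξ, real_inner_smul_right, inner_neg_right,
        real_inner_self_eq_norm_sq]
      ring
    rw [sub_apply, h5] at h4
    rw [map_sub] at h3
    have h6 : ε₁ * ‖y - x‖ ≤ ε₁ * (2 * ‖ξ‖) := by gcongr
    have h7 : (1 - σ) * ‖G‖ * (s * ‖G‖) < (3 * ε₁ + M * ε₂) * (s * ‖G‖) := by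
      rw [← hξn] at hlt ⊢
      simp only at h2
      have : s * ‖G‖ ^ 2 = ‖G‖ * ‖ξ‖ := by rw [hξn]; ring
      nlinarith
    have h8 := lt_of_mul_lt_mul_right h7 (by positivity)
    nlinarith

lemma IsALSSequence.exists_step (hV : IsALSSequence f R abar β σ c V) (habar : 0 < abar)
    (hβ : β ∈ Set.Ioo (0 : ℝ) 1) (hc : c ∈ Set.Ioo (0 : ℝ) 1) (k : ℕ) :
    ∃ t, 0 < t ∧ IsArmijoStep f R abar β σ (V k) (-rgrad f (V k)) t ∧
      c * σ * (t * ‖rgrad f (V k)‖ ^ 2) ≤ f (V k) - f (V (k + 1)) := by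
  obtain ⟨t, ht, hstep⟩ := hV.step k
  obtain ⟨ht0, hdec, -⟩ := ht.spec habar hβ
  refine ⟨t, ht0, ht, ?_⟩
  have := mul_le_mul_of_nonneg_left hdec hc.1.le
  linarith

lemma IsALSSequence.antitone (hV : IsALSSequence f R abar β σ c V) (habar : 0 < abar)
    (hβ : β ∈ Set.Ioo (0 : ℝ) 1) (hσ : σ ∈ Set.Ioo (0 : ℝ) 1) (hc : c ∈ Set.Ioo (0 : ℝ) 1) :
    Antitone fun k => f (V k) := by
  refine antitone_nat_of_succ_le fun k => ?_
  obtain ⟨t, ht0, -, hdec⟩ := hV.exists_step habar hβ hc k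
  have : 0 ≤ c * σ * (t * ‖rgrad f (V k)‖ ^ 2) := by
    have := hc.1
    have := hσ.1
    positivity
  linarith

lemma IsALSSequence.tendsto_decrease (hf : ∀ x ∈ stiefel p d, ContDiffAt ℝ 2 f x)
    (hV : IsALSSequence f R abar β σ c V) (habar : 0 < abar)
    (hβ : β ∈ Set.Ioo (0 : ℝ) 1) (hσ : σ ∈ Set.Ioo (0 : ℝ) 1) (hc : c ∈ Set.Ioo (0 : ℝ) 1) :
    Tendsto (fun k => f (V k) - f (V (k + 1))) atTop (𝓝 0) := by
  have hcont : ContinuousOn f (stiefel p d) := fun x hx => (hf x hx).continuousAt.continuousWithinAt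
  obtain ⟨B, hB⟩ := (isCompact_stiefel (p := p) (d := d)).bddBelow_image hcont
  have hbdd : BddBelow (Set.range fun k => f (V k)) :=
    ⟨B, by rintro _ ⟨k, rfl⟩; exact hB ⟨V k, hV.mem k, rfl⟩⟩
  have h := tendsto_atTop_ciInf (hV.antitone habar hβ hσ hc) hbdd
  simpa using h.sub (h.comp (tendsto_add_atTop_nat 1))

lemma mem_stiefel_of_mapClusterPt (hV : ∀ k, V k ∈ stiefel p d) {a : Mat p d}
    (ha : MapClusterPt a atTop V) : a ∈ stiefel p d := by
  by_contra h
  obtain ⟨k, hk⟩ := (ha.frequently (isClosed_stiefel.isOpen_compl.mem_nhds h)).exists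
  exact hk (hV k)

/-- Near a noncritical cluster point infinitely many steps would each lower `f` by at least `c σ κ`,
whereas the decreases tend to 0. -/
theorem IsALSSequence.isCriticalPoint (hf : ∀ x ∈ stiefel p d, ContDiffAt ℝ 2 f x)
    (hR : IsRetraction R) (hV : IsALSSequence f R abar β σ c V) (habar : 0 < abar)
    (hβ : β ∈ Set.Ioo (0 : ℝ) 1) (hσ : σ ∈ Set.Ioo (0 : ℝ) 1) (hc : c ∈ Set.Ioo (0 : ℝ) 1)
    {a : Mat p d} (ha : MapClusterPt a atTop V) : IsCriticalPoint f a := by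
  have haS := mem_stiefel_of_mapClusterPt hV.mem ha
  refine ⟨haS, ?_⟩
  by_contra hg
  obtain ⟨κ, hκ, hev⟩ :=
    exists_armijo_decrease_lower_bound hR habar hβ hσ haS (hf a haS) hg
  have hcσ : 0 < c * σ := mul_pos hc.1 hσ.1
  have hfreq := ha.frequently (eventually_nhdsWithin_iff.1 hev)
  have hsmall := (hV.tendsto_decrease hf habar hβ hσ hc).eventually_lt_const (mul_pos hcσ hκ)
  obtain ⟨k, hk, hk'⟩ := (hfreq.and_eventually hsmall).exists
  obtain ⟨t, -, ht, hdec⟩ := hV.exists_step habar hβ hc k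
  have := mul_le_mul_of_nonneg_left (hk (hV.mem k) t ht) hcσ.le
  linarith

/-- Otherwise the sequence visits the compact set `{ε ≤ ‖grad f‖}` infinitely often and clusters
there, at a point that must be critical. -/
theorem IsALSSequence.tendsto_norm_rgrad (hf : ∀ x ∈ stiefel p d, ContDiffAt ℝ 2 f x)
    (hR : IsRetraction R) (hV : IsALSSequence f R abar β σ c V) (habar : 0 < abar)
    (hβ : β ∈ Set.Ioo (0 : ℝ) 1) (hσ : σ ∈ Set.Ioo (0 : ℝ) 1) (hc : c ∈ Set.Ioo (0 : ℝ) 1) :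
    Tendsto (fun k => ‖rgrad f (V k)‖) atTop (𝓝 0) := by
  by_contra hnot
  rw [Metric.tendsto_atTop'] at hnot
  push Not at hnot
  obtain ⟨ε, hε, hbig⟩ := hnot
  have hfreq : ∃ᶠ k in atTop, V k ∈ stiefel p d ∩ {x | ε ≤ ‖rgrad f x‖} := by
    rw [frequently_atTop]
    intro N
    obtain ⟨n, hn, hn'⟩ := hbig N
    rw [dist_zero_right, norm_norm] at hn'
    exact ⟨n, hn.le, hV.mem n, hn'⟩
  have hcont : ContinuousOn (fun x => ‖rgrad f x‖) (stiefel p d) := fun x hx =>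
    (contDiffAt_rgrad (hf x hx)).continuousAt.norm.continuousWithinAt
  have hK : IsCompact (stiefel p d ∩ {x | ε ≤ ‖rgrad f x‖}) :=
    isCompact_stiefel.of_isClosed_subset
      (hcont.preimage_isClosed_of_isClosed isClosed_stiefel isClosed_Ici) Set.inter_subset_left
  obtain ⟨a, ha, hclus⟩ := hK.exists_mapClusterPt_of_frequently hfreq
  have h0 := (hV.isCriticalPoint hf hR habar hβ hσ hc hclus).2
  have h1 : ε ≤ ‖rgrad f a‖ := ha.2
  rw [h0, norm_zero] at h1
  linarith

end

section

/-! ### Spectral bounds for symmetric operators -/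

/-- Both sides are expanded in an orthonormal eigenbasis and compared termwise. -/
lemma quadratic_bounds_of_eigenvalue_bounds {E : Type*} [NormedAddCommGroup E]
    [InnerProductSpace ℝ E] [FiniteDimensional ℝ E] {T : E →ₗ[ℝ] E} (hT : T.IsSymmetric) {l u : ℝ}
    (h : ∀ (μ : ℝ) (x : E), x ≠ 0 → T x = μ • x → l ≤ μ ∧ μ ≤ u) (x : E) :
    l * ‖x‖ ^ 2 ≤ inner ℝ (T x) x ∧ inner ℝ (T x) x ≤ u * ‖x‖ ^ 2 := by
  set b := hT.eigenvectorBasis rfl with hb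
  set e := hT.eigenvalues rfl with he
  have happ : ∀ i, T (b i) = e i • b i := fun i => hT.apply_eigenvectorBasis rfl i
  have hbd : ∀ i, l ≤ e i ∧ e i ≤ u := fun i =>
    h (e i) (b i) (b.orthonormal.ne_zero i) (happ i)
  have h1 : inner ℝ (T x) x = ∑ i, e i * inner ℝ x (b i) ^ 2 := by
    rw [← b.sum_inner_mul_inner]
    refine Finset.sum_congr rfl fun i _ => ?_
    rw [hT x (b i), happ, inner_smul_right, real_inner_comm x (b i)]
    ring
  have h2 : ‖x‖ ^ 2 = ∑ i, inner ℝ x (b i) ^ 2 := by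
    rw [← real_inner_self_eq_norm_sq, ← b.sum_inner_mul_inner]
    refine Finset.sum_congr rfl fun i _ => ?_
    rw [real_inner_comm x (b i)]
    ring
  rw [h1, h2, Finset.mul_sum, Finset.mul_sum]
  exact ⟨Finset.sum_le_sum fun i _ => mul_le_mul_of_nonneg_right (hbd i).1 (sq_nonneg _),
    Finset.sum_le_sum fun i _ => mul_le_mul_of_nonneg_right (hbd i).2 (sq_nonneg _)⟩

variable {p d : ℕ} {f : Mat p d → ℝ}

/-! ### The Lagrangian of the constraint `Vᵀ V = I` -/

/-- Right multiplication by a square matrix. -/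
def mulRight (p : ℕ) {d : ℕ} (S : Matrix (Fin d) (Fin d) ℝ) : Mat p d →L[ℝ] Mat p d :=
  LinearMap.toContinuousLinearMap
    { toFun := fun X => unmat (mat X * S)
      map_add' := fun X Y => by rw [mat_add, Matrix.add_mul, unmat_add]
      map_smul' := fun a X => by
        rw [mat_smul, Matrix.smul_mul, unmat_smul, RingHom.id_apply] }

lemma mulRight_apply (S : Matrix (Fin d) (Fin d) ℝ) (X : Mat p d) :
    mulRight p S X = unmat (mat X * S) := rfl

/-- The Lagrangian `f(X) - ⟨S, Xᵀ X - I⟩ / 2`. -/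
def lagrangian (f : Mat p d → ℝ) (S : Matrix (Fin d) (Fin d) ℝ) (X : Mat p d) : ℝ :=
  f X - 1 / 2 * (inner ℝ (mulRight p S X) X - S.trace)

/-- The Lagrange multiplier of `f` at `a`. -/
def multiplier (f : Mat p d → ℝ) (a : Mat p d) : Matrix (Fin d) (Fin d) ℝ :=
  symPart a (gradient f a)

lemma multiplier_transpose (f : Mat p d → ℝ) (a : Mat p d) :
    (multiplier f a)ᵀ = multiplier f a := symPart_transpose _ _

lemma lagrangian_of_mem {S : Matrix (Fin d) (Fin d) ℝ} (hS : Sᵀ = S) {x : Mat p d}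
    (hx : x ∈ stiefel p d) : lagrangian f S x = f x := by
  rw [lagrangian, mulRight_apply, inner_mul_eq_trace hS, symPart_self hx, Matrix.mul_one,
    sub_self, mul_zero, sub_zero]

lemma contDiffAt_lagrangian {n : WithTop ℕ∞} (S : Matrix (Fin d) (Fin d) ℝ) {x : Mat p d}
    (hf : ContDiffAt ℝ n f x) : ContDiffAt ℝ n (lagrangian f S) x :=
  hf.sub (contDiffAt_const.mul
    (((mulRight p S).contDiff.contDiffAt.inner ℝ contDiffAt_id).sub contDiffAt_const))

lemma fderiv_lagrangian_apply {S : Matrix (Fin d) (Fin d) ℝ} (hS : Sᵀ = S) {x : Mat p d}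
    (hf : DifferentiableAt ℝ f x) (v : Mat p d) :
    fderiv ℝ (lagrangian f S) x v = inner ℝ (gradient f x - mulRight p S x) v := by
  have hq : HasFDerivAt (fun X : Mat p d => inner ℝ (mulRight p S X) X) _ x :=
    (mulRight p S).hasFDerivAt.inner ℝ (hasFDerivAt_id x)
  have hL : HasFDerivAt (lagrangian f S) _ x :=
    hf.hasFDerivAt.sub ((hq.sub_const S.trace).const_mul (1 / 2))
  have hsym : inner ℝ (mulRight p S v) x = inner ℝ (mulRight p S x) v := by
    rw [mulRight_apply, mulRight_apply, inner_mul_eq_trace hS, inner_mul_eq_trace hS, symPart_comm]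
  rw [hL.fderiv, inner_sub_left, inner_gradient_eq_fderiv]
  simp [fderivInnerCLM_apply, hsym]
  ring

/-- The constraint term contributes the normal vector `x S`. This holds for any symmetric `S`, so
the multiplier of `a` can stay fixed while `x` moves. -/
lemma fderiv_lagrangian_of_mem_tangentSpace {S : Matrix (Fin d) (Fin d) ℝ} (hS : Sᵀ = S)
    {x ξ : Mat p d} (hf : DifferentiableAt ℝ f x) (hξ : ξ ∈ tangentSpace x) :
    fderiv ℝ (lagrangian f S) x ξ = inner ℝ (rgrad f x) ξ := by
  rw [fderiv_lagrangian_apply hS hf, inner_sub_left, mulRight_apply, inner_mul_eq_zero hS hξ,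
    sub_zero, rgrad, inner_proj_left hξ]

lemma fderiv_lagrangian_eq_zero {a : Mat p d} (hf : DifferentiableAt ℝ f a)
    (ha : rgrad f a = 0) : fderiv ℝ (lagrangian f (multiplier f a)) a = 0 := by
  ext v
  rw [fderiv_lagrangian_apply (multiplier_transpose f a) hf]
  have : gradient f a - mulRight p (multiplier f a) a = rgrad f a := rfl
  rw [this, ha, inner_zero_left, zero_apply]

/-- Near `a`, `DL(X) η` is `⟨grad f X, η⟩` plus the trace of `(sym(Xᵀ∇f X) - S) sym(Xᵀη)`. At `a`
the first factor vanishes by the choice of `S` and the second because `η` is tangent, so the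
correction `φ` has zero derivative. -/
lemma fderiv_fderiv_lagrangian {a : Mat p d} (hf : ContDiffAt ℝ 2 f a) (ξ : Mat p d)
    {η : Mat p d} (hη : η ∈ tangentSpace a) :
    fderiv ℝ (fderiv ℝ (lagrangian f (multiplier f a))) a ξ η = inner ℝ (rhess f a ξ) η := by
  set S := multiplier f a with hSdef
  have hS : Sᵀ = S := multiplier_transpose f a
  let φ : Mat p d → ℝ := fun X =>
    ∑ i, ∑ j, (symPart X (gradient f X) i j - S i j) * symPart X η j i
  have hφ : HasFDerivAt φ (0 : Mat p d →L[ℝ] ℝ) a := by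
    have hij : ∀ i j, HasFDerivAt
        (fun X : Mat p d => (symPart X (gradient f X) i j - S i j) * symPart X η j i)
        (0 : Mat p d →L[ℝ] ℝ) a := by
      intro i j
      have h1 : DifferentiableAt ℝ (fun X : Mat p d => symPart X (gradient f X) i j - S i j) a :=
        ((contDiffAt_symPart_apply contDiffAt_id (contDiffAt_gradient hf) i j).differentiableAt
          one_ne_zero).sub_const _
      have h2 : DifferentiableAt ℝ (fun X : Mat p d => symPart X η j i) a :=
        (contDiffAt_symPart_apply (n := 1) contDiffAt_id contDiffAt_const j i).differentiableAt
          one_ne_zero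
      have h3 : symPart a (gradient f a) i j - S i j = 0 := sub_self _
      have h4 : symPart a η j i = 0 := by rw [mem_tangentSpace_iff.1 hη]; rfl
      have h5 := h1.hasFDerivAt.mul h2.hasFDerivAt
      rw [h3, h4, zero_smul, zero_smul, add_zero] at h5
      exact h5
    have h6 := HasFDerivAt.fun_sum (u := Finset.univ) fun i _ =>
      HasFDerivAt.fun_sum (u := Finset.univ) fun j _ => hij i j
    simpa only [Finset.sum_const_zero] using h6
  have hG : HasFDerivAt (fun X => inner ℝ (rgrad f X) η) _ a :=
    (((contDiffAt_rgrad hf).differentiableAt one_ne_zero).hasFDerivAt).inner ℝ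
      (hasFDerivAt_const η a)
  have heq : (fun X => fderiv ℝ (lagrangian f S) X η) =ᶠ[𝓝 a]
      fun X => inner ℝ (rgrad f X) η + φ X := by
    filter_upwards [hf.eventually (by simp)] with X hX
    rw [fderiv_lagrangian_apply hS (hX.differentiableAt two_ne_zero)]
    have hsplit : gradient f X - mulRight p S X = rgrad f X +
        unmat (mat X * (symPart X (gradient f X) - S)) := by
      rw [rgrad, proj_eq, mulRight_apply, Matrix.mul_sub, unmat_sub]
      abel
    have hsym : (symPart X (gradient f X) - S)ᵀ = symPart X (gradient f X) - S := by
      rw [Matrix.transpose_sub, symPart_transpose, hS]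
    rw [hsplit, inner_add_left, inner_mul_eq_trace hsym]
    simp only [Matrix.trace, Matrix.diag_apply, Matrix.mul_apply, Matrix.sub_apply, φ]
  have hL : DifferentiableAt ℝ (fderiv ℝ (lagrangian f S)) a :=
    ((contDiffAt_lagrangian S hf).fderiv_right (m := 1) (by norm_num)).differentiableAt
      one_ne_zero
  have hL' : HasFDerivAt (fun X => fderiv ℝ (lagrangian f S) X η) _ a :=
    hL.hasFDerivAt.clm_apply (hasFDerivAt_const η a)
  have hu := congrArg (fun A : Mat p d →L[ℝ] ℝ => A ξ)
    (hL'.unique ((hG.add hφ).congr_of_eventuallyEq heq))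
  rw [rhess, inner_proj_left hη]
  simpa [fderivInnerCLM_apply] using hu

/-- Symmetry of the ambient second derivative makes the Riemannian Hessian self-adjoint on the
tangent space, so its extreme eigenvalues bound the form. -/
lemma hessian_lagrangian_bounds {a : Mat p d} (ha : a ∈ stiefel p d) (hf : ContDiffAt ℝ 2 f a)
    {l u : ℝ} (hl : l ∈ lowerBounds (hessEigenvalues f a))
    (hu : u ∈ upperBounds (hessEigenvalues f a)) {ζ : Mat p d} (hζ : ζ ∈ tangentSpace a) :
    l * ‖ζ‖ ^ 2 ≤ fderiv ℝ (fderiv ℝ (lagrangian f (multiplier f a))) a ζ ζ ∧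
      fderiv ℝ (fderiv ℝ (lagrangian f (multiplier f a))) a ζ ζ ≤ u * ‖ζ‖ ^ 2 := by
  let T : tangentSubmodule a →ₗ[ℝ] tangentSubmodule a :=
    { toFun := fun ξ => ⟨rhess f a ξ, proj_mem ha _⟩
      map_add' := fun ξ η => Subtype.ext (by
        simp only [rhess, Submodule.coe_add, map_add, proj_add])
      map_smul' := fun c ξ => Subtype.ext (by
        simp only [rhess, Submodule.coe_smul, map_smul, proj_smul, RingHom.id_apply]) }
  have hTapp : ∀ ξ, (T ξ : Mat p d) = rhess f a ξ := fun _ => rfl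
  have hsymm : IsSymmSndFDerivAt ℝ (lagrangian f (multiplier f a)) a :=
    (contDiffAt_lagrangian _ hf).isSymmSndFDerivAt (by simp)
  have hT : T.IsSymmetric := by
    intro ξ η
    rw [Submodule.coe_inner, Submodule.coe_inner, hTapp, hTapp, real_inner_comm _ (ξ : Mat p d),
      ← fderiv_fderiv_lagrangian hf _ η.2, ← fderiv_fderiv_lagrangian hf _ ξ.2]
    exact hsymm _ _
  have hb := quadratic_bounds_of_eigenvalue_bounds hT (l := l) (u := u) (fun μ ξ hξ hξμ => by
    have hmem : μ ∈ hessEigenvalues f a :=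
      ⟨ξ, ξ.2, fun h => hξ (Subtype.ext h), congrArg Subtype.val hξμ⟩
    exact ⟨hl hmem, hu hmem⟩) ⟨ζ, hζ⟩
  rw [fderiv_fderiv_lagrangian hf _ hζ]
  exact hb

end

section

variable {p d : ℕ} {f L : Mat p d → ℝ} {R : Mat p d → Mat p d → Mat p d} {abar β σ c l u : ℝ}
  {a : Mat p d} {V : ℕ → Mat p d}

/-! ### Local estimates near a nondegenerate minimizer -/

lemma proj_neg (V Z : Mat p d) : proj V (-Z) = -proj V Z := by
  rw [← neg_one_smul ℝ, proj_smul, neg_one_smul]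

/-- The chord is tangent to second order at both ends, and `proj` is Lipschitz in its base point.
All points of the manifold have the same norm, which makes the constants uniform. -/
lemma eventually_proj_close (ha : a ∈ stiefel p d) {η : ℝ} (hη : 0 < η) :
    ∀ᶠ x in 𝓝[stiefel p d] a, ‖proj a (a - x) - (a - x)‖ ≤ η * ‖a - x‖ ∧
      ‖(a - x) - proj x (a - x)‖ ≤ η * ‖a - x‖ ∧
      ∀ ξ ∈ tangentSpace x, ‖proj a ξ - ξ‖ ≤ η * ‖ξ‖ := by
  have hd : ∀ x ∈ stiefel p d, ‖x‖ = ‖a‖ := fun x hx => by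
    rw [← sq_eq_sq₀ (norm_nonneg _) (norm_nonneg _), norm_sq_of_mem_stiefel hx,
      norm_sq_of_mem_stiefel ha]
  have hcont : Tendsto (fun x : Mat p d => 2 * ‖a‖ * ‖a - x‖) (𝓝[stiefel p d] a) (𝓝 0) := by
    have : Continuous fun x : Mat p d => 2 * ‖a‖ * ‖a - x‖ := by fun_prop
    simpa using (this.tendsto a).mono_left nhdsWithin_le_nhds
  filter_upwards [self_mem_nhdsWithin, hcont.eventually_lt_const hη] with x hx hsmall
  have hn := norm_nonneg (a - x)
  have hna : ‖a‖ * ‖a - x‖ ≤ η := by nlinarith [mul_nonneg (norm_nonneg a) hn]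
  have hsq : ‖a‖ * ‖a - x‖ ^ 2 ≤ η * ‖a - x‖ := by nlinarith
  refine ⟨?_, ?_, fun ξ hξ => ?_⟩
  · rw [norm_sub_rev]
    exact (norm_sub_proj_le ha hx).trans hsq
  · have h := norm_sub_proj_le hx ha
    rw [hd x hx, norm_sub_rev x a] at h
    have he : (a - x) - proj x (a - x) = -((x - a) - proj x (x - a)) := by
      rw [← neg_sub x a, proj_neg]
      abel
    rw [he, norm_neg]
    exact h.trans hsq
  · have h := norm_proj_sub_proj_le a x ξ
    rw [proj_of_mem hξ, hd x hx, ← two_mul] at h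
    exact h.trans (by gcongr)

/-- `L` is a `C²` function on the ambient space that agrees with `f` on the Stiefel manifold, has a
critical point at `a`, and whose second derivative at `a` lies between `l` and `u` on the tangent
space. -/
structure IsLocalModel (f L : Mat p d → ℝ) (a : Mat p d) (l u : ℝ) : Prop where
  mem : a ∈ stiefel p d
  contDiffAt : ContDiffAt ℝ 2 L a
  eq_of_mem : ∀ x ∈ stiefel p d, L x = f x
  fderiv_eq_zero : fderiv ℝ L a = 0
  fderiv_tangent : ∀ x ∈ stiefel p d, ∀ ξ ∈ tangentSpace x,
    fderiv ℝ L x ξ = inner ℝ (rgrad f x) ξ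
  pos : 0 < l
  le : l ≤ u
  bounds : ∀ ζ ∈ tangentSpace a, l * ‖ζ‖ ^ 2 ≤ fderiv ℝ (fderiv ℝ L) a ζ ζ ∧
    fderiv ℝ (fderiv ℝ L) a ζ ζ ≤ u * ‖ζ‖ ^ 2

/-- With `h = a - x`, Taylor expansion at `x` gives `f x - f a ≤ ‖G‖‖h‖ - ½(l-ε)‖h‖²`, and
maximizing over `‖h‖` yields the first bound. Pairing `DL(x) ≈ -H h` with `h` gives `‖h‖ ≤
(2/l)‖G‖`, hence the second: the full ambient derivative, normal part included, is controlled by the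
Riemannian gradient. -/
lemma IsLocalModel.eventually_gradient_bounds (hL : IsLocalModel f L a l u) {ε : ℝ} (hε : 0 < ε)
    (hεl : ε < l) :
    ∀ᶠ x in 𝓝[stiefel p d] a, 2 * (l - ε) * (f x - f a) ≤ ‖rgrad f x‖ ^ 2 ∧
      ‖fderiv ℝ L x‖ ≤ (‖fderiv ℝ (fderiv ℝ L) a‖ + 1) * (2 / l) * ‖rgrad f x‖ := by
  set H := fderiv ℝ (fderiv ℝ L) a with hH
  set C := ‖H‖ + 1 with hC
  have hCpos : 0 < C := by positivity
  -- Taylor remainder `ε/6`, half the quadratic-form loss `ε/12` and the normal part of the chord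
  -- `ε/12` stay within the allowed `ε/2`.
  obtain ⟨ε', hε', hε'eq⟩ : ∃ ε' > 0, 6 * ε' = ε := ⟨ε / 6, by positivity, by ring⟩
  obtain ⟨η₀, hη₀, hquad⟩ := exists_quadratic_bounds H hL.pos hL.le hL.bounds hε'
  obtain ⟨η, hη, hηη₀, hηC⟩ : ∃ η > 0, η ≤ η₀ ∧ 12 * (C * η) ≤ ε := by
    refine ⟨min η₀ (ε / (12 * C)), lt_min hη₀ (by positivity), min_le_left _ _, ?_⟩
    have h := min_le_right η₀ (ε / (12 * C))
    rw [le_div_iff₀ (by positivity)] at h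
    linarith
  obtain ⟨δ, hδ, htaylor⟩ := exists_taylor_two_uniform hL.contDiffAt hε'
  filter_upwards [self_mem_nhdsWithin, eventually_proj_close hL.mem hη,
    mem_nhdsWithin_of_mem_nhds (Metric.ball_mem_nhds a hδ),
    mem_nhdsWithin_of_mem_nhds (eventually_norm_fderiv_sub_le hL.contDiffAt hε'),
    mem_nhdsWithin_of_mem_nhds (eventually_norm_fderiv_sub_le hL.contDiffAt one_pos)]
    with x hx hclose hxδ hx1 hx2
  obtain ⟨hc1, hc2, -⟩ := hclose
  have hxa : x - a = -(a - x) := (neg_sub a x).symm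
  set h := a - x with hh
  clear_value h
  set G := rgrad f x with hG
  have hGT : G ∈ tangentSpace x := rgrad_mem hx
  rw [hL.fderiv_eq_zero, sub_zero, hxa, norm_neg, ← hH, map_neg, sub_neg_eq_add] at hx1 hx2
  have hn := norm_nonneg h
  have hD : ‖fderiv ℝ L x‖ ≤ C * ‖h‖ := by
    have h1 := norm_sub_le (fderiv ℝ L x + H h) (H h)
    rw [add_sub_cancel_right] at h1
    have h2 := H.le_opNorm h
    nlinarith
  have hQ := (hquad h h (proj a h) (proj_mem hL.mem h) (by simpa using by positivity)
    (hc1.trans (by gcongr))).1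
  have hDh : |fderiv ℝ L x h - inner ℝ G h| ≤ C * η * ‖h‖ ^ 2 := by
    have he : fderiv ℝ L x h - inner ℝ G h = fderiv ℝ L x (h - proj x h) := by
      rw [map_sub (fderiv ℝ L x) h, hL.fderiv_tangent x hx _ (proj_mem hx h), inner_proj_right hGT]
    rw [he]
    refine ((fderiv ℝ L x).le_opNorm _).trans ?_
    calc ‖fderiv ℝ L x‖ * ‖h - proj x h‖ ≤ (C * ‖h‖) * (η * ‖h‖) := by gcongr
      _ = C * η * ‖h‖ ^ 2 := by ring
  have hGh : -inner ℝ G h ≤ ‖G‖ * ‖h‖ := (neg_le_abs _).trans (abs_real_inner_le_norm G h)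
  have hDh' := (abs_le.1 hDh).1
  have hsq := sq_nonneg ‖h‖
  have hηh : 12 * (C * η * ‖h‖ ^ 2) ≤ ε * ‖h‖ ^ 2 := by nlinarith
  have hεn : 0 ≤ ε * ‖h‖ ^ 2 := by positivity
  have hεh : 6 * (ε' * ‖h‖ ^ 2) = ε * ‖h‖ ^ 2 := by rw [← hε'eq]; ring
  constructor
  · have ht := htaylor x hxδ a (Metric.mem_ball_self hδ)
    rw [← hH, ← hh, hL.eq_of_mem x hx, hL.eq_of_mem a hL.mem] at ht
    have ht' := (abs_le.1 ht).1
    have hle : f x - f a ≤ ‖G‖ * ‖h‖ - 1 / 2 * (l - ε) * ‖h‖ ^ 2 := by linarith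
    have hpos : 0 < l - ε := sub_pos.2 hεl
    have := mul_le_mul_of_nonneg_left hle (by positivity : 0 ≤ 2 * (l - ε))
    nlinarith [sq_nonneg (‖G‖ - (l - ε) * ‖h‖)]
  · have h1 : (fderiv ℝ L x + H h) h ≤ ε' * ‖h‖ ^ 2 := by
      refine (le_abs_self _).trans (((fderiv ℝ L x + H h).le_opNorm h).trans ?_)
      rw [pow_two, ← mul_assoc]
      gcongr
    rw [add_apply] at h1
    have hεl' : ε * ‖h‖ ^ 2 ≤ l * ‖h‖ ^ 2 := by gcongr
    have h2 : l / 2 * ‖h‖ ^ 2 ≤ ‖G‖ * ‖h‖ := by linarith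
    have h3 : ‖h‖ ≤ 2 / l * ‖G‖ := by
      have hl := hL.pos
      rw [div_mul_eq_mul_div, le_div_iff₀ hl]
      rcases hn.eq_or_lt with h0 | h0
      · rw [← h0, zero_mul]; positivity
      · have : l / 2 * ‖h‖ ≤ ‖G‖ := le_of_mul_le_mul_right (by linarith) h0
        linarith
    calc ‖fderiv ℝ L x‖ ≤ C * ‖h‖ := hD
      _ ≤ C * (2 / l * ‖G‖) := by gcongr
      _ = C * (2 / l) * ‖G‖ := by ring

/-- The retraction is controlled only to first order. Its defect `y - x - ξ = o(‖ξ‖)` is weighted by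
`DL(x) = O(‖grad f x‖)`, so it costs `ε‖G‖‖ξ‖`, and no second-order property of `R` is needed. -/
lemma IsLocalModel.exists_upper_bound (hL : IsLocalModel f L a l u) (hR : IsRetraction R) {ε : ℝ}
    (hε : 0 < ε) :
    ∃ δ > 0, ∀ᶠ x in 𝓝[stiefel p d] a, ∀ ξ ∈ tangentSpace x, ‖ξ‖ < δ →
      f (R x ξ) ≤ f x + inner ℝ (rgrad f x) ξ + ε * ‖rgrad f x‖ * ‖ξ‖ +
        1 / 2 * (u + ε) * ‖ξ‖ ^ 2 := by
  set H := fderiv ℝ (fderiv ℝ L) a with hH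
  have hl := hL.pos
  obtain ⟨C, hCpos, hC⟩ : ∃ C > 0, ∀ᶠ x in 𝓝[stiefel p d] a, ‖fderiv ℝ L x‖ ≤ C * ‖rgrad f x‖ :=
    ⟨_, by positivity, (hL.eventually_gradient_bounds (half_pos hl) (half_lt_self hl)).mono
      fun x hx => hx.2⟩
  obtain ⟨η, hη, hquad⟩ := exists_quadratic_bounds H hl hL.le hL.bounds (half_pos hε)
  obtain ⟨ε₁, hε₁, hε₁1, hε₁η, hε₁C⟩ : ∃ ε₁ > 0, ε₁ ≤ 1 ∧ ε₁ ≤ η ∧ C * ε₁ ≤ ε := by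
    refine ⟨min 1 (min η (ε / C)), lt_min one_pos (lt_min hη (by positivity)), min_le_left _ _,
      (min_le_right _ _).trans (min_le_left _ _), ?_⟩
    rw [← le_div_iff₀' hCpos]
    exact (min_le_right _ _).trans (min_le_right _ _)
  obtain ⟨δ₁, hδ₁, hret⟩ := hR.exists_norm_sub_le hL.mem hε₁
  -- As `‖y - x‖ ≤ 2‖ξ‖`, the remainder is at most `(ε/4)‖ξ‖²`; the quadratic form supplies the
  -- other `ε/4`.
  obtain ⟨δ₂, hδ₂, htaylor⟩ := exists_taylor_two_uniform hL.contDiffAt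
    (by positivity : 0 < ε / 16)
  refine ⟨min δ₁ (δ₂ / 4), lt_min hδ₁ (by positivity), ?_⟩
  filter_upwards [self_mem_nhdsWithin, hC, eventually_proj_close hL.mem hη,
    mem_nhdsWithin_of_mem_nhds (Metric.ball_mem_nhds a hδ₁),
    mem_nhdsWithin_of_mem_nhds (Metric.ball_mem_nhds a (half_pos hδ₂))]
    with x hx hxC hclose hxδ₁ hxδ₂ ξ hξ hξδ
  rw [mem_ball_iff_norm] at hxδ₁ hxδ₂
  have hξ1 : ‖ξ‖ < δ₁ := hξδ.trans_le (min_le_left _ _)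
  have hξ2 : ‖ξ‖ < δ₂ / 4 := hξδ.trans_le (min_le_right _ _)
  have hyx := hret x hx hxδ₁ ξ hξ hξ1
  have hyS : R x ξ ∈ stiefel p d := hR.mapsTo x hx ξ hξ
  set y := R x ξ with hy
  set G := rgrad f x with hG
  have hn := norm_nonneg ξ
  have hyx2 : ‖y - x‖ ≤ 2 * ‖ξ‖ := by
    have := norm_add_le (y - x - ξ) ξ
    rw [sub_add_cancel] at this
    nlinarith
  have hya : ‖y - a‖ < δ₂ := by
    have := norm_add_le (y - x) (x - a)
    rw [sub_add_sub_cancel] at this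
    linarith
  have ht := htaylor x (mem_ball_iff_norm.2 (by linarith)) y (mem_ball_iff_norm.2 hya)
  rw [hL.eq_of_mem x hx, hL.eq_of_mem y hyS] at ht
  have ht' := (abs_le.1 ht).2
  have hQ := (hquad ξ (y - x) (proj a ξ) (proj_mem hL.mem ξ) (hyx.trans (by gcongr))
    (hclose.2.2 ξ hξ)).2
  have h1 : fderiv ℝ L x (y - x - ξ) ≤ ε * ‖G‖ * ‖ξ‖ := by
    refine (le_abs_self _).trans (((fderiv ℝ L x).le_opNorm _).trans ?_)
    calc ‖fderiv ℝ L x‖ * ‖y - x - ξ‖ ≤ (C * ‖G‖) * (ε₁ * ‖ξ‖) := by gcongr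
      _ = (C * ε₁) * (‖G‖ * ‖ξ‖) := by ring
      _ ≤ ε * (‖G‖ * ‖ξ‖) := by gcongr
      _ = ε * ‖G‖ * ‖ξ‖ := by ring
  rw [map_sub, hL.fderiv_tangent x hx ξ hξ] at h1
  have h2 : ε / 16 * ‖y - x‖ ^ 2 ≤ ε / 4 * ‖ξ‖ ^ 2 := by
    have : ‖y - x‖ ^ 2 ≤ (2 * ‖ξ‖) ^ 2 := by gcongr
    nlinarith
  rw [← hH] at ht'
  linarith

/-- The decrease guaranteed by an Armijo step near a nondegenerate minimizer is at least a fixed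
fraction of the optimality gap. -/
lemma IsLocalModel.eventually_armijo_decrease (hL : IsLocalModel f L a l u)
    (hf : ContDiffAt ℝ 2 f a) (hcrit : rgrad f a = 0) (hR : IsRetraction R) (habar : 0 < abar)
    (hβ : β ∈ Set.Ioo (0 : ℝ) 1) (hσ : σ ∈ Set.Ioo (0 : ℝ) 1) {r : ℝ}
    (hr : rStar abar β σ l u < r) (hr1 : r < 1) :
    ∀ᶠ x in 𝓝[stiefel p d] a, ∀ t, IsArmijoStep f R abar β σ x (-rgrad f x) t →
      (1 - r) * (f x - f a) ≤ σ * t * ‖rgrad f x‖ ^ 2 := by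
  have hl := hL.pos
  have hu : 0 < u := hl.trans_le hL.le
  have hσ0 := hσ.1
  have hβ0 := hβ.1
  have hmin : 1 - r < min (2 * σ * abar * l) (4 * σ * (1 - σ) * β * (l / u)) := by
    rw [rStar] at hr
    linarith
  obtain ⟨hm1, hm2⟩ := lt_min_iff.1 hmin
  rw [← mul_div_assoc, lt_div_iff₀ hu] at hm2
  -- Since `r` strictly exceeds `rStar`, both rate inequalities survive a small perturbation `ε`, by
  -- continuity at 0.
  obtain ⟨ε, ⟨h1, h2, h3⟩, hε⟩ : ∃ ε : ℝ, (1 - r < 2 * σ * abar * (l - ε) ∧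
      (1 - r) * (u + ε) < 4 * σ * (1 - σ - ε) * β * (l - ε) ∧ ε < l) ∧ 0 < ε := by
    have e1 : ∀ᶠ ε in 𝓝 (0 : ℝ), 1 - r < 2 * σ * abar * (l - ε) :=
      (show Continuous fun ε : ℝ => 2 * σ * abar * (l - ε) by
        fun_prop).continuousAt.eventually_const_lt (by simpa using hm1)
    have e2 : ∀ᶠ ε in 𝓝 (0 : ℝ), (1 - r) * (u + ε) < 4 * σ * (1 - σ - ε) * β * (l - ε) :=
      (show Continuous fun ε : ℝ => (1 - r) * (u + ε) by fun_prop).continuousAt.eventually_lt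
        (show Continuous fun ε : ℝ => 4 * σ * (1 - σ - ε) * β * (l - ε) by
          fun_prop).continuousAt (by simpa using hm2)
    have e3 : ∀ᶠ ε in 𝓝 (0 : ℝ), ε < l := eventually_lt_nhds hl
    exact (((e1.and (e2.and e3)).filter_mono nhdsWithin_le_nhds).and
      (self_mem_nhdsWithin (s := Set.Ioi (0 : ℝ)))).exists
  have hlε : 0 < l - ε := sub_pos.2 h3
  obtain ⟨δ, hδ, hup⟩ := hL.exists_upper_bound hR hε
  -- Every trial displacement has length at most `abar * ‖grad f x‖`, which is small near the
  -- critical point, so the upper bound applies to rejected trials.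
  have hGsmall : ∀ᶠ x in 𝓝 a, abar * ‖rgrad f x‖ < δ := by
    have hc : ContinuousAt (fun x => abar * ‖rgrad f x‖) a :=
      continuousAt_const.mul (contDiffAt_rgrad hf).continuousAt.norm
    exact hc.eventually_lt_const (by simpa [hcrit] using hδ)
  filter_upwards [self_mem_nhdsWithin, hup, hL.eventually_gradient_bounds hε h3,
    mem_nhdsWithin_of_mem_nhds hGsmall] with x hx hxup hxG hxsmall t ht
  obtain ⟨ht0, -, hcase⟩ := ht.spec habar hβ
  set G := rgrad f x with hG
  have hGT : G ∈ tangentSpace x := rgrad_mem hx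
  have hPL := hxG.1
  have hGsq := sq_nonneg ‖G‖
  rcases lt_or_ge (f x - f a) 0 with hneg | hnn
  · have e1 : (1 - r) * (f x - f a) ≤ 0 :=
      mul_nonpos_of_nonneg_of_nonpos (by linarith) hneg.le
    exact e1.trans (by positivity)
  rcases hcase with rfl | ⟨s, hs0, hs1, rfl, hfail⟩
  · calc (1 - r) * (f x - f a) ≤ 2 * σ * t * (l - ε) * (f x - f a) := by gcongr
      _ = σ * t * (2 * (l - ε) * (f x - f a)) := by ring
      _ ≤ σ * t * ‖G‖ ^ 2 := by gcongr
  · have hξn : ‖s • -G‖ = s * ‖G‖ := by rw [norm_smul, norm_neg, Real.norm_of_nonneg hs0.le]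
    have hub := hxup (s • -G) (smul_mem_tangentSpace ((tangentSubmodule x).neg_mem hGT) s) (by
      rw [hξn]
      exact (mul_le_mul_of_nonneg_right hs1 (norm_nonneg _)).trans_lt hxsmall)
    rw [hξn, real_inner_smul_right, inner_neg_right, real_inner_self_eq_norm_sq] at hub
    -- Rejection of `s` against the upper bound: this is the lower bound on `s`, kept multiplied by
    -- `‖G‖²` to allow `G = 0`.
    have hstep : 2 * (1 - σ - ε) * ‖G‖ ^ 2 ≤ (u + ε) * s * ‖G‖ ^ 2 := by
      refine le_of_mul_le_mul_left ?_ hs0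
      nlinarith
    have huε : 0 < u + ε := by positivity
    refine le_of_mul_le_mul_left ?_ huε
    have hσε : 0 ≤ 1 - σ - ε := by
      by_contra! hneg
      have : 0 ≤ (1 - r) * (u + ε) := mul_nonneg (by linarith) huε.le
      have : 4 * σ * (1 - σ - ε) * β * (l - ε) ≤ 0 := by
        have : 0 ≤ 4 * σ * β * (l - ε) := by positivity
        nlinarith
      linarith
    calc (u + ε) * ((1 - r) * (f x - f a)) = (1 - r) * (u + ε) * (f x - f a) := by ring
      _ ≤ 4 * σ * (1 - σ - ε) * β * (l - ε) * (f x - f a) := by gcongr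
      _ = σ * β * (2 * (1 - σ - ε) * (2 * (l - ε) * (f x - f a))) := by ring
      _ ≤ σ * β * (2 * (1 - σ - ε) * ‖G‖ ^ 2) := by gcongr
      _ ≤ σ * β * ((u + ε) * s * ‖G‖ ^ 2) := by gcongr
      _ = (u + ε) * (σ * (β * s) * ‖G‖ ^ 2) := by ring

/-! ### Linear rate from the local estimates. -/

lemma isLocalModel_lagrangian (hf : ∀ x ∈ stiefel p d, ContDiffAt ℝ 2 f x)
    (ha : IsCriticalPoint f a) (hl : IsLeast (hessEigenvalues f a) l)
    (hu : IsGreatest (hessEigenvalues f a) u) (hl0 : 0 < l) :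
    IsLocalModel f (lagrangian f (multiplier f a)) a l u where
  mem := ha.1
  contDiffAt := contDiffAt_lagrangian _ (hf a ha.1)
  eq_of_mem _ hx := lagrangian_of_mem (multiplier_transpose f a) hx
  fderiv_eq_zero := fderiv_lagrangian_eq_zero ((hf a ha.1).differentiableAt two_ne_zero) ha.2
  fderiv_tangent x hx _ hξ := fderiv_lagrangian_of_mem_tangentSpace (multiplier_transpose f a)
    ((hf x hx).differentiableAt two_ne_zero) hξ
  pos := hl0
  le := hl.2 hu.1
  bounds _ hζ := hessian_lagrangian_bounds ha.1 (hf a ha.1) hl.2 hu.2 hζ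

/-- Positivity comes from `4σ(1-σ) ≤ 1` and `l/u ≤ 1`, which bound the second term of the minimum by
`β < 1`. -/
lemma rStar_mem_Ioo (habar : 0 < abar) (hβ : β ∈ Set.Ioo (0 : ℝ) 1)
    (hσ : σ ∈ Set.Ioo (0 : ℝ) 1) (hl : 0 < l) (hlu : l ≤ u) :
    rStar abar β σ l u ∈ Set.Ioo (0 : ℝ) 1 := by
  have hu : 0 < u := hl.trans_le hlu
  have hσ0 := hσ.1
  have hσ1 : 0 < 1 - σ := sub_pos.2 hσ.2
  have hβ0 := hβ.1
  have h1 : 4 * σ * (1 - σ) ≤ 1 := by nlinarith [sq_nonneg (2 * σ - 1)]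
  have h2 : l / u ≤ 1 := (div_le_one hu).2 hlu
  have h3 : 4 * σ * (1 - σ) * β * (l / u) ≤ β :=
    calc 4 * σ * (1 - σ) * β * (l / u) ≤ 1 * β * 1 := by gcongr
      _ = β := by ring
  have h4 := min_le_right (2 * σ * abar * l) (4 * σ * (1 - σ) * β * (l / u))
  have h5 : 0 < min (2 * σ * abar * l) (4 * σ * (1 - σ) * β * (l / u)) :=
    lt_min (by positivity) (by positivity)
  constructor
  · rw [rStar]; linarith [hβ.2]
  · rw [rStar]; linarith

/-- The line search keeps a fraction `c` of the Armijo decrease `(1-r)(f x - f a)`, and `1 - c(1-r)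
= r + (1-r)(1-c)`. -/
theorem IsALSSequence.eventually_contraction (hf : ∀ x ∈ stiefel p d, ContDiffAt ℝ 2 f x)
    (hR : IsRetraction R) (hV : IsALSSequence f R abar β σ c V) (habar : 0 < abar)
    (hβ : β ∈ Set.Ioo (0 : ℝ) 1) (hσ : σ ∈ Set.Ioo (0 : ℝ) 1) (hc : c ∈ Set.Ioo (0 : ℝ) 1)
    (hlim : Tendsto V atTop (𝓝 a)) (ha : IsCriticalPoint f a)
    (hl : IsLeast (hessEigenvalues f a) l) (hu : IsGreatest (hessEigenvalues f a) u)
    (hl0 : 0 < l) {r : ℝ} (hr : rStar abar β σ l u < r) (hr1 : r < 1) :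
    ∀ᶠ k in atTop, f (V (k + 1)) - f a ≤ (r + (1 - r) * (1 - c)) * (f (V k) - f a) := by
  have hev := (isLocalModel_lagrangian hf ha hl hu hl0).eventually_armijo_decrease
    (hf a ha.1) ha.2 hR habar hβ hσ hr hr1
  have hVlim : Tendsto V atTop (𝓝[stiefel p d] a) :=
    tendsto_nhdsWithin_iff.2 ⟨hlim, .of_forall hV.mem⟩
  filter_upwards [hVlim.eventually hev] with k hk
  obtain ⟨t, -, ht, hdec⟩ := hV.exists_step habar hβ hc k
  have := mul_le_mul_of_nonneg_left (hk t ht) hc.1.le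
  linarith

end

end CIR

end

theorem theorem3 {p d : ℕ} (f : CIR.Mat p d → ℝ) (hf : CIR.IsCIRLoss.{u, v} p d f)
    (R : CIR.Mat p d → CIR.Mat p d → CIR.Mat p d) (hR : CIR.IsRetraction R)
    (abar β σ c : ℝ) (habar : 0 < abar) (hβ : β ∈ Set.Ioo (0 : ℝ) 1)
    (hσ : σ ∈ Set.Ioo (0 : ℝ) 1) (hc : c ∈ Set.Ioo (0 : ℝ) 1)
    (V : ℕ → CIR.Mat p d) (hV : CIR.IsALSSequence f R abar β σ c V) :
    (∀ Vstar : CIR.Mat p d, MapClusterPt Vstar atTop V → CIR.IsCriticalPoint f Vstar) ∧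
    Tendsto (fun k => ‖CIR.rgrad f (V k)‖) atTop (𝓝 0) ∧
    ∀ Vstar : CIR.Mat p d, Tendsto V atTop (𝓝 Vstar) →
      IsLocalMinOn f (CIR.stiefel p d) Vstar →
      ∀ lamL lamU : ℝ, IsLeast (CIR.hessEigenvalues f Vstar) lamL →
        IsGreatest (CIR.hessEigenvalues f Vstar) lamU → 0 < lamL →
        CIR.rStar abar β σ lamL lamU < 1 ∧
        ∀ r ∈ Set.Ioo (CIR.rStar abar β σ lamL lamU) 1,
          r + (1 - r) * (1 - c) ∈ Set.Ioo (0 : ℝ) 1 ∧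
          ∃ K : ℕ, K ≠ 0 ∧ ∀ k ≥ K,
            f (V (k + 1)) - f Vstar ≤ (r + (1 - r) * (1 - c)) * (f (V k) - f Vstar) := by
  have hC : ∀ x ∈ CIR.stiefel p d, ContDiffAt ℝ 2 f x := fun x hx => hf.contDiffAt hx
  refine ⟨fun a ha => hV.isCriticalPoint hC hR habar hβ hσ hc ha,
    hV.tendsto_norm_rgrad hC hR habar hβ hσ hc, ?_⟩
  intro a hlim _ l u hl hu hl0
  have hrs := CIR.rStar_mem_Ioo habar hβ hσ hl0 (hl.2 hu.1)
  refine ⟨hrs.2, fun r hr => ⟨?_, ?_⟩⟩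
  · have hr0 : 0 < r := hrs.1.trans hr.1
    have hr1 : 0 < 1 - r := sub_pos.2 hr.2
    have hc1 : 0 < 1 - c := sub_pos.2 hc.2
    constructor
    · positivity
    · nlinarith [mul_pos hr1 hc.1]
  -- The limit is a cluster point, so criticality comes from the global part.
  · have hcrit := hV.isCriticalPoint hC hR habar hβ hσ hc hlim.mapClusterPt
    obtain ⟨K, hK⟩ := eventually_atTop.1
      (hV.eventually_contraction hC hR habar hβ hσ hc hlim hcrit hl hu hl0 hr.1 hr.2)
    exact ⟨K + 1, K.succ_ne_zero, fun k hk => hK k (by omega)⟩
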